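/- For a bounded domain (nonempty connected bounded open set) $\Omega\subset\mathbb{C}^n$, let $A^2(\Omega)$ be the Hilbert space of holomorphic functions on $\Omega$ that are square-integrable with respect to Lebesgue measure, let $K_\Omega(z,\xi)=\sum_j s_j(z)\overline{s_j(\xi)}$ be its Bergman kernel, where $\{s_j\}$ is any complete orthonormal basis of $A^2(\Omega)$, and let $$g_\Omega(z)=\sum_{\alpha,\beta=1}^n \frac{\partial^2\log K_\Omega(z,z)}{\partial z_\alpha\,\partial\bar z_\beta}\,dz_\alpha\otimes d\bar z_\beta$$ be its Bergman metric. Let $\Omega_1,\Omega_2\subset\mathbb{C}^n$ be bounded domains and let $f:\Omega_1\to\Omega_2$ be a proper holomorphic map. If there are a constant $\lambda>0$ and a nonempty open subset $U\subset\Omega_1$ such that $f^*g_{\Omega_2}=\lambda\, g_{\Omega_1}$ on $U$, then $f$ is a biholomorphism of $\Omega_1$ onto $\Omega_2$, that is, $f$ is bijective and its inverse $\Omega_2\to\Omega_1$ is holomorphic. -/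

import Mathlib

open MeasureTheory Set
open scoped ComplexConjugate

noncomputable section

/-- A bounded domain in `ℂⁿ`: a nonempty, connected, open, bounded set. The space `ℂⁿ` is
`Fin n → ℂ`; its sup norm is only used for the topology and for boundedness, where it agrees with
the Euclidean norm, and its `volume` is Lebesgue measure. -/
structure IsBoundedDomain {n : ℕ} (Ω : Set (Fin n → ℂ)) : Prop where
  isOpen : IsOpen Ω
  isConnected : IsConnected Ω
  isBounded : Bornology.IsBounded Ω

/-- The Bergman space `A²(Ω)` of square-integrable holomorphic functions on `Ω`, as a subspace of
`L²(Ω)`, from which it inherits its inner product. -/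
def bergmanSpace {n : ℕ} (Ω : Set (Fin n → ℂ)) :
    Submodule ℂ (Lp ℂ 2 ((volume : Measure (Fin n → ℂ)).restrict Ω)) where
  carrier := {u | ∃ h : (Fin n → ℂ) → ℂ, DifferentiableOn ℂ h Ω ∧
    u =ᵐ[(volume : Measure (Fin n → ℂ)).restrict Ω] h}
  zero_mem' := ⟨0, differentiableOn_const 0, Lp.coeFn_zero _ _ _⟩
  add_mem' := by
    rintro u v ⟨h, hh, hu⟩ ⟨k, hk, hv⟩
    exact ⟨h + k, hh.add hk, (Lp.coeFn_add u v).trans (hu.add hv)⟩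
  smul_mem' := by
    rintro c u ⟨h, hh, hu⟩
    exact ⟨c • h, hh.const_smul c, (Lp.coeFn_smul c u).trans (hu.const_smul c)⟩

/-- The holomorphic function on `Ω` represented by an element of `A²(Ω)`. For open `Ω` its values
on `Ω` are determined by the class; the values outside `Ω` are irrelevant. -/
def bergmanRep {n : ℕ} {Ω : Set (Fin n → ℂ)} (u : bergmanSpace Ω) : (Fin n → ℂ) → ℂ :=
  Classical.choose u.2

/-- `B` is a complete orthonormal system in `A²(Ω)`: it is orthonormal and only the zero function
is orthogonal to all of its members. -/
def IsCompleteOrthonormalSystem {n : ℕ} {Ω : Set (Fin n → ℂ)} (B : Set (bergmanSpace Ω)) : Prop :=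
  Orthonormal ℂ (fun s : B => (s : bergmanSpace Ω)) ∧
    ∀ u : bergmanSpace Ω, (∀ s ∈ B, inner ℂ s u = 0) → u = 0

theorem exists_isCompleteOrthonormalSystem {n : ℕ} (Ω : Set (Fin n → ℂ)) :
    ∃ B : Set (bergmanSpace Ω), IsCompleteOrthonormalSystem B := by
  obtain ⟨B, -, hB, hmax⟩ := exists_maximal_orthonormal (𝕜 := ℂ) (s := (∅ : Set (bergmanSpace Ω)))
    (orthonormal_empty ℂ _)
  refine ⟨B, hB, fun u hu => ?_⟩
  have h := (maximal_orthonormal_iff_orthogonalComplement_eq_bot hB).1 hmax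
  rw [← Submodule.mem_bot ℂ, ← h, Submodule.mem_orthogonal]
  intro v hv
  induction hv using Submodule.span_induction with
  | mem x hx => exact hu x hx
  | zero => simp
  | add x y _ _ hx hy => rw [inner_add_left, hx, hy, add_zero]
  | smul a x _ hx => rw [inner_smul_left, hx, mul_zero]

/-- A complete orthonormal system in `A²(Ω)` (the Bergman kernel does not depend on the choice). -/
def bergmanBasis {n : ℕ} (Ω : Set (Fin n → ℂ)) : Set (bergmanSpace Ω) :=
  Classical.choose (exists_isCompleteOrthonormalSystem Ω)

/-- The Bergman kernel `K(z, ξ) = ∑ s_j(z) conj (s_j(ξ))` for `z, ξ ∈ Ω`. -/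
def bergmanKernel {n : ℕ} (Ω : Set (Fin n → ℂ)) (z ξ : Fin n → ℂ) : ℂ :=
  ∑' s : bergmanBasis Ω, bergmanRep (s : bergmanSpace Ω) z * conj (bergmanRep (s : bergmanSpace Ω) ξ)

/-- The Wirtinger derivative `∂F/∂z_α = (1/2) (∂F/∂x_α - i ∂F/∂y_α)`. -/
def wirtingerDz {n : ℕ} (α : Fin n) (F : (Fin n → ℂ) → ℂ) (z : Fin n → ℂ) : ℂ :=
  (1 / 2 : ℂ) *
    (fderiv ℝ F z (Pi.single α 1) - Complex.I * fderiv ℝ F z (Pi.single α Complex.I))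

/-- The Wirtinger derivative `∂F/∂z̄_β = (1/2) (∂F/∂x_β + i ∂F/∂y_β)`. -/
def wirtingerDzbar {n : ℕ} (β : Fin n) (F : (Fin n → ℂ) → ℂ) (z : Fin n → ℂ) : ℂ :=
  (1 / 2 : ℂ) *
    (fderiv ℝ F z (Pi.single β 1) + Complex.I * fderiv ℝ F z (Pi.single β Complex.I))

/-- The coefficients `g_{α β̄}(z) = ∂²/∂z_α∂z̄_β log K(z, z)` of the Bergman metric. (The value
`K(z, z)` is a nonnegative real number.) -/
def bergmanMetricCoeff {n : ℕ} (Ω : Set (Fin n → ℂ)) (z : Fin n → ℂ) (α β : Fin n) : ℂ :=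
  wirtingerDz α
    (wirtingerDzbar β (fun w => ((Real.log (bergmanKernel Ω w w).re : ℝ) : ℂ))) z

/-- The Bergman metric `g_B = ∑ g_{α β̄} dz_α ⊗ dz̄_β` at `z`, evaluated on `X, Y ∈ ℂⁿ`. -/
def bergmanMetric {n : ℕ} (Ω : Set (Fin n → ℂ)) (z X Y : Fin n → ℂ) : ℂ :=
  ∑ α, ∑ β, bergmanMetricCoeff Ω z α β * X α * conj (Y β)

/-- The pullback `f^* g` of a metric under a holomorphic map:
`(f^* g)_z (X, Y) = g_{f(z)} (df_z X, df_z Y)`. -/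
def pullbackMetric {n : ℕ} (f : (Fin n → ℂ) → (Fin n → ℂ))
    (g : (Fin n → ℂ) → (Fin n → ℂ) → (Fin n → ℂ) → ℂ) (z X Y : Fin n → ℂ) : ℂ :=
  g (f z) (fderiv ℂ f z X) (fderiv ℂ f z Y)

/-- `f` restricts to a biholomorphism of `Ω₁` onto `Ω₂`: it is holomorphic with a holomorphic
two-sided inverse. -/
def IsBiholomorphismOn {n : ℕ} (f : (Fin n → ℂ) → (Fin n → ℂ)) (Ω₁ Ω₂ : Set (Fin n → ℂ)) : Prop :=
  MapsTo f Ω₁ Ω₂ ∧ DifferentiableOn ℂ f Ω₁ ∧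
    ∃ g : (Fin n → ℂ) → (Fin n → ℂ), MapsTo g Ω₂ Ω₁ ∧ DifferentiableOn ℂ g Ω₂ ∧ InvOn g f Ω₁ Ω₂

end

/-! Evaluation at `z` is a bounded functional on `A²(Ω)`. Identifying the dual with `ℓ²` gives a
holomorphic Bergman map `Φ` with `K(z, z) = ‖Φ z‖²`, and the Bergman metric is the pullback under
`Φ` of the Fubini-Study form (`exists_bergmanMap`, `bergmanMetric_eq_fubiniStudy`). Because `Ω` is
bounded, `1` and the coordinates lie in `A²(Ω)`, so continuous linear maps recover `1` and `z` from
`Φ z`: `Φ` is injective and immersive even projectively.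

The maps `Φ₂ ∘ f` and `Φ₁` thus pull back forms proportional by `c` near a point. Calabi's argument
upgrades this to an identity between pairs of points. Polarizing `∂∂̄ log ‖Φ‖²` and integrating
twice shows that the normalized square `|⟪Φ a, Φ z⟫|² / (‖Φ a‖² ‖Φ z‖²)` of `Φ₂ ∘ f` is the `c`-th
power of that of `Φ₁`. Both the metric identity and this relation extend to all of `Ω₁` by real
analyticity (`fubiniStudy_eq_of_eventually`, `calabiRelation_of_fubiniStudy_eq`).

If `f a = f z`, the quantity for `Φ₂ ∘ f` is `1`, hence so is that of `Φ₁`. Equality in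
Cauchy-Schwarz makes `Φ₁ a` and `Φ₁ z` proportional, so `a = z`. The infinitesimal version of the
same argument shows that `df` is injective. An injective proper local biholomorphism has open and
closed image, hence is onto the connected set `Ω₂`. -/

open Metric Filter Topology

/-! ### Holomorphic maps between complex normed spaces -/

section SeveralVariables

variable {E G : Type*} [NormedAddCommGroup E] [NormedSpace ℂ E] [NormedAddCommGroup G]
  [NormedSpace ℂ G]

/-- Cauchy's estimate for the Fréchet derivative. -/
theorem norm_fderiv_le_of_norm_le_ball {F : E → G} {z : E} {r C : ℝ} (hr : 0 < r)
    (hF : DifferentiableOn ℂ F (ball z r)) (hC : ∀ w ∈ ball z r, ‖F w‖ ≤ C) :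
    ‖fderiv ℂ F z‖ ≤ 2 * C / r := by
  refine Complex.norm_fderiv_le_div_of_mapsTo_ball hF (fun w hw => ?_) hr
  rw [mem_closedBall, dist_eq_norm]
  linarith [norm_sub_le (F w) (F z), hC w hw, hC z (mem_ball_self hr)]

/-- The second order Taylor estimate for a bounded holomorphic map. -/
theorem norm_sub_sub_fderiv_le_of_norm_le_ball {F : E → G} {z h : E} {r C : ℝ}
    (hF : DifferentiableOn ℂ F (ball z r)) (hC : ∀ w ∈ ball z r, ‖F w‖ ≤ C) (hh : ‖h‖ < r) :
    ‖F (z + h) - F z - fderiv ℂ F z h‖ ≤ 4 * C * (‖h‖ / r) ^ 2 := by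
  have hr : 0 < r := (norm_nonneg h).trans_lt hh
  have hz := mem_ball_self (x := z) hr
  have hC0 : 0 ≤ C := (norm_nonneg _).trans (hC z hz)
  have hd : DifferentiableAt ℂ F z := hF.differentiableAt (isOpen_ball.mem_nhds hz)
  -- Removing the linear part makes `g - g z` vanish to second order, so the Schwarz lemma yields a
  -- square. The constant is `C + 2C + C`: the value, the linear part by Cauchy's estimate, and the
  -- value at the centre.
  set g : E → G := fun w => F w - fderiv ℂ F z (w - z) with hg
  have hgz : g z = F z := by simp [hg]
  have key := Complex.dist_le_mul_div_pow_of_mapsTo_ball_of_isLittleO (f := g) (c := z)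
    (z := z + h) (R₁ := r) (R₂ := 4 * C) (n := 1) ?_ ?_ ?_ ?_
  · rw [dist_eq_norm, hgz] at key
    simpa [hg, dist_eq_norm, sub_right_comm] using key
  · exact hF.sub ((fderiv ℂ F z).differentiable.comp
      (differentiable_id.sub_const z)).differentiableOn
  · intro w hw
    rw [mem_closedBall, dist_eq_norm, hgz]
    have h1 : ‖fderiv ℂ F z (w - z)‖ ≤ 2 * C / r * r :=
      ((fderiv ℂ F z).le_opNorm _).trans (mul_le_mul (norm_fderiv_le_of_norm_le_ball hr hF hC)
        (by rw [← dist_eq_norm]; exact (mem_ball.1 hw).le) (norm_nonneg _) (by positivity))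
    rw [div_mul_cancel₀ _ hr.ne'] at h1
    have h2 := norm_sub_le (F w - fderiv ℂ F z (w - z)) (F z)
    have h3 := norm_sub_le (F w) (fderiv ℂ F z (w - z))
    simp only [hg]
    linarith [hC w hw, hC z hz]
  · have := hd.hasFDerivAt.isLittleO
    simp only [hgz, pow_one]
    refine (this.congr_left fun w => ?_).norm_right
    simp only [hg]; abel
  · simpa [dist_eq_norm] using hh

/-- Uniform limits of holomorphic maps on a ball are holomorphic (Weierstrass). -/
theorem differentiableAt_of_tendstoUniformlyOn_ball [CompleteSpace G] {F : ℕ → E → G} {u : E → G}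
    {z : E} {r : ℝ} (hr : 0 < r) (hF : ∀ k, DifferentiableOn ℂ (F k) (ball z r))
    (hu : TendstoUniformlyOn F u atTop (ball z r)) : DifferentiableAt ℂ u z := by
  have hsub : ∀ x ∈ ball z (r / 2), ball x (r / 2) ⊆ ball z r := fun x hx =>
    ball_subset_ball' (by linarith [mem_ball.1 hx])
  have hdiff : ∀ k, ∀ x ∈ ball z (r / 2), DifferentiableAt ℂ (F k) x := fun k x hx =>
    (hF k).differentiableAt (isOpen_ball.mem_nhds (ball_subset_ball (by linarith) hx))
  have hcauchy : UniformCauchySeqOn (fun k => fderiv ℂ (F k)) atTop (ball z (r / 2)) := by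
    rw [Metric.uniformCauchySeqOn_iff]
    intro ε hε
    obtain ⟨N, hN⟩ := Metric.uniformCauchySeqOn_iff.1 hu.uniformCauchySeqOn (ε * r / 8)
      (by positivity)
    refine ⟨N, fun m hm n hn x hx => ?_⟩
    rw [dist_eq_norm, ← fderiv_fun_sub (hdiff m x hx) (hdiff n x hx)]
    refine (norm_fderiv_le_of_norm_le_ball (r := r / 2) (C := ε * r / 8) (by positivity)
      (((hF m).sub (hF n)).mono (hsub x hx)) fun w hw => ?_).trans_lt ?_
    · simpa only [dist_eq_norm, Pi.sub_apply] using (hN m hm n hn w (hsub x hx hw)).le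
    · field_simp; linarith
  have hlim : ∀ x, ∃ L, x ∈ ball z (r / 2) →
      Tendsto (fun k => fderiv ℂ (F k) x) atTop (𝓝 L) := by
    intro x
    by_cases hx : x ∈ ball z (r / 2)
    · obtain ⟨L, hL⟩ := cauchySeq_tendsto_of_complete (hcauchy.cauchySeq hx)
      exact ⟨L, fun _ => hL⟩
    · exact ⟨0, fun h => absurd h hx⟩
  choose L hL using hlim
  exact (hasFDerivAt_of_tendstoUniformlyOn isOpen_ball
    (hcauchy.tendstoUniformlyOn_of_tendsto fun x hx => hL x hx)
    (fun k x hx => (hdiff k x hx).hasFDerivAt)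
    (fun x hx => hu.tendsto_at (ball_subset_ball (by linarith) hx))
    (mem_ball_self (by positivity : 0 < r / 2))).differentiableAt

/-- A directional derivative of a holomorphic map is holomorphic (Goursat). -/
theorem differentiableOn_fderiv_apply [CompleteSpace G] {F : E → G} {Ω : Set E}
    (hΩ : IsOpen Ω) (hF : DifferentiableOn ℂ F Ω) (X : E) :
    DifferentiableOn ℂ (fun z => fderiv ℂ F z X) Ω := by
  intro z hz
  have hcont : ContinuousAt F z := (hF.differentiableAt (hΩ.mem_nhds hz)).continuousAt
  obtain ⟨R, hR, hball⟩ := Metric.mem_nhds_iff.1 (inter_mem (hΩ.mem_nhds hz)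
    (hcont (ball_mem_nhds (F z) one_pos)))
  set r := R / 2 with hr
  have hr0 : 0 < r := by positivity
  set C := ‖F z‖ + 1 with hCdef
  have hsub : ∀ w ∈ ball z r, ball w r ⊆ ball z R := fun w hw =>
    ball_subset_ball' (by linarith [mem_ball.1 hw])
  have hFd : ∀ w ∈ ball z r, DifferentiableOn ℂ F (ball w r) := fun w hw =>
    hF.mono fun x hx => (hball (hsub w hw hx)).1
  have hFC : ∀ w ∈ ball z r, ∀ x ∈ ball w r, ‖F x‖ ≤ C := fun w hw x hx => by
    have h1 : dist (F x) (F z) < 1 := (hball (hsub w hw hx)).2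
    rw [dist_eq_norm] at h1
    linarith [norm_le_norm_add_norm_sub' (F x) (F z)]
  -- Every increment `e k • X` then has norm below `r`. The difference quotients along it converge
  -- uniformly to the derivative, with Taylor error at most `e k * 4C (‖X‖ / r)²`.
  set δ : ℝ := r / (‖X‖ + 1) with hδ
  have hX : (0 : ℝ) < ‖X‖ + 1 := by positivity
  have hδ0 : 0 < δ := by positivity
  set e : ℕ → ℝ := fun k => δ * (1 / ((k : ℝ) + 1)) with he
  have he0 : ∀ k, 0 < e k := fun k => by simp only [he]; positivity
  have heδ : ∀ k, e k ≤ δ := fun k => by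
    simp only [he]
    refine mul_le_of_le_one_right hδ0.le ?_
    rw [div_le_one (by positivity)]
    linarith [(Nat.cast_nonneg k : (0 : ℝ) ≤ k)]
  have helim : Tendsto e atTop (𝓝 0) := by
    simpa [he] using (tendsto_one_div_add_atTop_nhds_zero_nat (𝕜 := ℝ)).const_mul δ
  have heX : ∀ k, ‖((e k : ℂ)) • X‖ < r := fun k => by
    rw [norm_smul, Complex.norm_real, Real.norm_of_nonneg (he0 k).le]
    calc e k * ‖X‖ ≤ δ * ‖X‖ := by gcongr; exact heδ k
      _ < δ * (‖X‖ + 1) := by gcongr; linarith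
      _ = r := by rw [hδ]; field_simp
  refine (differentiableAt_of_tendstoUniformlyOn_ball hr0
    (F := fun k w => ((e k : ℂ))⁻¹ • (F (w + (e k : ℂ) • X) - F w)) (fun k w hw => ?_)
    ?_).differentiableWithinAt
  · have hmem : w + (e k : ℂ) • X ∈ ball w r := by simpa [dist_eq_norm] using heX k
    have h1 : DifferentiableAt ℂ F (w + (e k : ℂ) • X) :=
      hF.differentiableAt (hΩ.mem_nhds (hball (hsub w hw hmem)).1)
    have h2 : DifferentiableAt ℂ F w :=
      hF.differentiableAt (hΩ.mem_nhds (hball (hsub w hw (mem_ball_self hr0))).1)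
    have h3 : DifferentiableAt ℂ (fun w => F (w + (e k : ℂ) • X)) w :=
      h1.comp w (differentiableAt_id.add_const _)
    exact ((h3.sub h2).const_smul _).differentiableWithinAt
  · rw [Metric.tendstoUniformlyOn_iff]
    intro ε hε
    have hlim : Tendsto (fun k => e k * (4 * C * (‖X‖ / r) ^ 2)) atTop (𝓝 0) := by
      simpa using helim.mul_const (4 * C * (‖X‖ / r) ^ 2)
    filter_upwards [hlim.eventually (gt_mem_nhds hε)] with k hk w hw
    have hek : (e k : ℂ) ≠ 0 := by exact_mod_cast (he0 k).ne'
    have h1 := norm_sub_sub_fderiv_le_of_norm_le_ball (hFd w hw) (hFC w hw) (heX k)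
    rw [dist_eq_norm, ← norm_neg]
    have h2 : -(fderiv ℂ F w X - (e k : ℂ)⁻¹ • (F (w + (e k : ℂ) • X) - F w)) =
        (e k : ℂ)⁻¹ • (F (w + (e k : ℂ) • X) - F w - fderiv ℂ F w ((e k : ℂ) • X)) := by
      rw [map_smul, smul_sub _ (F (w + (e k : ℂ) • X) - F w), smul_smul, inv_mul_cancel₀ hek,
        one_smul]
      abel
    rw [h2, norm_smul, norm_inv, Complex.norm_real, Real.norm_of_nonneg (he0 k).le]
    refine lt_of_le_of_lt ?_ hk
    calc (e k)⁻¹ * ‖F (w + (e k : ℂ) • X) - F w - fderiv ℂ F w ((e k : ℂ) • X)‖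
        ≤ (e k)⁻¹ * (4 * C * (‖(e k : ℂ) • X‖ / r) ^ 2) := by
          have := he0 k
          gcongr
      _ = e k * (4 * C * (‖X‖ / r) ^ 2) := by
          rw [norm_smul, Complex.norm_real, Real.norm_of_nonneg (he0 k).le]
          have := (he0 k).ne'
          field_simp

/-- A locally bounded operator-valued map is holomorphic if it is pointwise holomorphic. -/
theorem differentiableAt_clm_of_apply {M : Type*} [NormedAddCommGroup M] [NormedSpace ℂ M]
    {P : E → M →L[ℂ] G} {z : E} {r C : ℝ} (hr : 0 < r)
    (hP : ∀ m, DifferentiableOn ℂ (fun w => P w m) (ball z r))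
    (hC : ∀ w ∈ ball z r, ‖P w‖ ≤ C) : DifferentiableAt ℂ P z := by
  have hz := mem_ball_self (x := z) hr
  have hC0 : 0 ≤ C := (norm_nonneg _).trans (hC z hz)
  have hd : ∀ m, DifferentiableAt ℂ (fun w => P w m) z := fun m =>
    (hP m).differentiableAt (isOpen_ball.mem_nhds hz)
  have hCm : ∀ m, ∀ w ∈ ball z r, ‖P w m‖ ≤ C * ‖m‖ := fun m w hw =>
    ((P w).le_opNorm m).trans (by gcongr; exact hC w hw)
  -- The candidate derivative is assembled from the pointwise ones. Cauchy's estimate bounds it, and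
  -- the Taylor remainder is linear in `‖m‖`, so the pointwise expansions hold in operator norm.
  let L : E →L[ℂ] M →L[ℂ] G := LinearMap.mkContinuous₂
    (LinearMap.mk₂ ℂ (fun h m => fderiv ℂ (fun w => P w m) z h) (fun _ _ _ => map_add _ _ _)
      (fun _ _ _ => map_smul _ _ _)
      (fun h m m' => by
        simp only [map_add]
        rw [fderiv_fun_add (hd m) (hd m')]; rfl)
      (fun c h m => by
        simp only [map_smul]
        rw [fderiv_fun_const_smul (hd m)]; rfl))
    (2 * C / r) (fun h m => by
      have := norm_fderiv_le_of_norm_le_ball hr (hP m) (hCm m)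
      refine ((fderiv ℂ (fun w => P w m) z).le_opNorm h).trans ?_
      calc ‖fderiv ℂ (fun w => P w m) z‖ * ‖h‖ ≤ 2 * (C * ‖m‖) / r * ‖h‖ := by gcongr
        _ = 2 * C / r * ‖h‖ * ‖m‖ := by ring)
  have hL : HasFDerivAt P L z := by
    rw [hasFDerivAt_iff_isLittleO_nhds_zero]
    refine Asymptotics.IsBigO.trans_isLittleO (g := fun h : E => ‖h‖ ^ 2) ?_
      (Asymptotics.isLittleO_norm_pow_id one_lt_two)
    refine Asymptotics.IsBigO.of_bound (4 * C / r ^ 2) ?_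
    filter_upwards [ball_mem_nhds (0 : E) hr] with h hh
    have hh' : ‖h‖ < r := by simpa using hh
    refine ContinuousLinearMap.opNorm_le_bound _ (by positivity) fun m => ?_
    have := norm_sub_sub_fderiv_le_of_norm_le_ball (hP m) (hCm m) hh'
    calc ‖(P (z + h) - P z - L h) m‖ ≤ 4 * (C * ‖m‖) * (‖h‖ / r) ^ 2 := this
      _ = 4 * C / r ^ 2 * ‖‖h‖ ^ 2‖ * ‖m‖ := by
        rw [Real.norm_of_nonneg (by positivity)]; ring
  exact hL.differentiableAt

end SeveralVariables

/-! ### The mean value property on polydiscs -/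

section MeanValue

variable {n : ℕ}

theorem volume_preserving_circle_smul (a : Circle) :
    MeasurePreserving (fun w : Fin n → ℂ => (a : ℂ) • w) :=
  volume_preserving_pi (fun _ => (rotation a).measurePreserving)

theorem setIntegral_closedBall_circle_smul (a : Circle) (r : ℝ) (u : (Fin n → ℂ) → ℂ) :
    ∫ w in closedBall (0 : Fin n → ℂ) r, u ((a : ℂ) • w) = ∫ w in closedBall 0 r, u w := by
  have h := (volume_preserving_circle_smul (n := n) a).setIntegral_preimage_emb
    (Homeomorph.smulOfNeZero (α := Fin n → ℂ) (a : ℂ)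
      a.coe_ne_zero).isClosedEmbedding.measurableEmbedding u (closedBall 0 r)
  rw [← h]
  congr 2
  ext w
  simp [norm_smul, Circle.norm_coe]

/-- The mean value property of holomorphic functions of several variables on polydiscs. -/
theorem setIntegral_closedBall_of_differentiableOn {u : (Fin n → ℂ) → ℂ} {z : Fin n → ℂ} {r R : ℝ}
    (hrR : r < R) (hu : DifferentiableOn ℂ u (ball z R)) :
    ∫ w in closedBall z r, u w = volume.real (closedBall z r) * u z := by
  set B := closedBall (0 : Fin n → ℂ) r with hB
  have hmem : ∀ w ∈ B, ∀ t : ℂ, ‖t‖ ≤ 1 → z + t • w ∈ ball z R := by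
    intro w hw t ht
    rw [mem_ball, dist_eq_norm, add_sub_cancel_left, norm_smul]
    calc ‖t‖ * ‖w‖ ≤ 1 * r := by gcongr; simpa [hB] using hw
      _ < R := by linarith
  have hpre : (fun w => z + w) ⁻¹' closedBall z r = B := by
    ext w; simp [hB]
  have htrans : ∫ w in closedBall z r, u w = ∫ w in B, u (z + w) := by
    rw [← (measurePreserving_add_left volume z).setIntegral_preimage_emb
      (measurableEmbedding_addLeft z) u (closedBall z r), hpre]
  have hvol : volume.real B = volume.real (closedBall z r) := by
    simp only [Measure.real, hB, Measure.addHaar_closedBall_center volume z]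
  -- One-variable mean value property on the complex line through `z` in direction `w`. Integrating
  -- over `w` and exchanging integrals gives the claim, since by rotation invariance every angle
  -- contributes the same integral.
  have hcirc : ∀ w ∈ B, ∫ θ in (0 : ℝ)..2 * Real.pi, u (z + circleMap 0 1 θ • w) =
      ((2 * Real.pi : ℝ) : ℂ) * u z := by
    intro w hw
    have hd : DiffContOnCl ℂ (fun t : ℂ => u (z + t • w)) (ball 0 |1|) := by
      refine DifferentiableOn.diffContOnCl fun t ht => ?_
      have ht' : ‖t‖ ≤ 1 := by
        simpa using closure_ball_subset_closedBall ht
      have h1 : DifferentiableAt ℂ u (z + t • w) :=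
        hu.differentiableAt (isOpen_ball.mem_nhds (hmem w hw t ht'))
      exact (h1.comp t ((differentiableAt_id.smul_const w).const_add z)).differentiableWithinAt
    have h := hd.circleAverage
    rw [Real.circleAverage_def] at h
    simp only [zero_smul, add_zero] at h
    rw [← h, Complex.real_smul, ← mul_assoc, ← Complex.ofReal_mul,
      mul_inv_cancel₀ (by positivity), Complex.ofReal_one, one_mul]
  have hrot : ∀ θ : ℝ, ∫ w in B, u (z + circleMap 0 1 θ • w) = ∫ w in B, u (z + w) := by
    intro θ
    have := setIntegral_closedBall_circle_smul (n := n) (Circle.exp θ) r (fun w => u (z + w))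
    simpa [circleMap] using this
  have hint : Integrable (Function.uncurry fun (θ : ℝ) (w : Fin n → ℂ) =>
      u (z + circleMap 0 1 θ • w))
      ((volume.restrict (Set.uIoc 0 (2 * Real.pi))).prod (volume.restrict B)) := by
    rw [Measure.prod_restrict]
    have hc : ContinuousOn (Function.uncurry fun (θ : ℝ) (w : Fin n → ℂ) =>
        u (z + circleMap 0 1 θ • w)) (Set.uIcc 0 (2 * Real.pi) ×ˢ B) := by
      refine hu.continuousOn.comp ?_ ?_
      · refine Continuous.continuousOn ?_
        exact continuous_const.add (((continuous_circleMap 0 1).comp continuous_fst).smul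
          continuous_snd)
      · rintro ⟨θ, w⟩ ⟨_, hw⟩
        exact hmem w hw _ (by simp)
    have := hc.integrableOn_compact (μ := (volume : Measure ℝ).prod (volume : Measure (Fin n → ℂ)))
      (isCompact_uIcc.prod (isCompact_closedBall 0 r))
    exact this.mono_set (Set.prod_mono Set.uIoc_subset_uIcc subset_rfl)
  have hswap := intervalIntegral_integral_swap hint
  simp only [hrot] at hswap
  rw [setIntegral_congr_fun measurableSet_closedBall hcirc, intervalIntegral.integral_const,
    setIntegral_const, sub_zero] at hswap
  have hpi : (2 * Real.pi : ℝ) ≠ 0 := by positivity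
  rw [htrans, ← hvol]
  have hpi' : ((2 * Real.pi : ℝ) : ℂ) ≠ 0 := by exact_mod_cast hpi
  refine mul_left_cancel₀ hpi' ?_
  rw [Complex.real_smul, Complex.real_smul] at hswap
  rw [hswap]; ring

end MeanValue

/-! ### Point evaluation bounds and completeness of the Bergman space -/

section BergmanSpace

variable {n : ℕ} {Ω : Set (Fin n → ℂ)}

/-- Point evaluation of a square-integrable holomorphic function is an inner product in `L²`. -/
theorem norm_le_of_ae_eq_of_ball_subset {r R : ℝ} (hr : 0 < r) (hrR : r < R) {z : Fin n → ℂ}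
    (hball : ball z R ⊆ Ω) {h : (Fin n → ℂ) → ℂ} (hh : DifferentiableOn ℂ h Ω)
    {u : Lp ℂ 2 ((volume : Measure (Fin n → ℂ)).restrict Ω)}
    (hu : u =ᵐ[(volume : Measure (Fin n → ℂ)).restrict Ω] h) :
    ‖h z‖ ≤ (volume.real (closedBall (0 : Fin n → ℂ) r))⁻¹ *
      volume.real (closedBall (0 : Fin n → ℂ) r) ^ (1 / 2 : ℝ) * ‖u‖ := by
  have hsub : closedBall z r ⊆ Ω := (closedBall_subset_ball hrR).trans hball
  have hvol : volume.real (closedBall z r) = volume.real (closedBall (0 : Fin n → ℂ) r) := by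
    simp only [Measure.real, Measure.addHaar_closedBall_center volume z]
  have hpos : 0 < volume.real (closedBall (0 : Fin n → ℂ) r) :=
    ENNReal.toReal_pos (measure_closedBall_pos _ _ hr).ne' measure_closedBall_lt_top.ne
  have hrest : (volume.restrict Ω).restrict (closedBall z r) =
      volume.restrict (closedBall z r) := Measure.restrict_restrict_of_subset hsub
  have hμ : (volume.restrict Ω) (closedBall z r) = volume (closedBall z r) := by
    rw [Measure.restrict_apply measurableSet_closedBall, inter_eq_left.2 hsub]
  have hfin : (volume.restrict Ω) (closedBall z r) ≠ ⊤ := by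
    rw [hμ]; exact measure_closedBall_lt_top.ne
  have hμr : (volume.restrict Ω).real (closedBall z r) =
      volume.real (closedBall (0 : Fin n → ℂ) r) := by
    rw [← hvol, measureReal_def, hμ, measureReal_def]
  have h1 : ∫ w in closedBall z r, u w ∂(volume.restrict Ω) =
      volume.real (closedBall (0 : Fin n → ℂ) r) * h z := by
    rw [← hvol, ← setIntegral_closedBall_of_differentiableOn hrR (hh.mono hball), ← hrest]
    exact integral_congr_ae (ae_restrict_of_ae hu)
  have h2 := L2.inner_indicatorConstLp_one (𝕜 := ℂ) measurableSet_closedBall hfin u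
  have h3 := norm_inner_le_norm (𝕜 := ℂ)
    (indicatorConstLp 2 measurableSet_closedBall hfin (1 : ℂ)) u
  rw [h2, h1, norm_indicatorConstLp (by norm_num) (by norm_num), norm_mul, Complex.norm_real,
    Real.norm_of_nonneg hpos.le, norm_one, one_mul, hμr] at h3
  rw [mul_assoc, ← div_eq_inv_mul, le_div_iff₀ hpos, mul_comm]
  simpa using h3

theorem differentiableOn_bergmanRep (u : bergmanSpace Ω) : DifferentiableOn ℂ (bergmanRep u) Ω :=
  (Classical.choose_spec u.2).1

theorem coeFn_ae_eq_bergmanRep (u : bergmanSpace Ω) :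
    (u : Lp ℂ 2 ((volume : Measure (Fin n → ℂ)).restrict Ω))
      =ᵐ[(volume : Measure (Fin n → ℂ)).restrict Ω] bergmanRep u :=
  (Classical.choose_spec u.2).2

theorem bergmanRep_eqOn (hΩ : IsOpen Ω) {u : bergmanSpace Ω} {h : (Fin n → ℂ) → ℂ}
    (hh : DifferentiableOn ℂ h Ω)
    (hu : (u : Lp ℂ 2 ((volume : Measure (Fin n → ℂ)).restrict Ω))
      =ᵐ[(volume : Measure (Fin n → ℂ)).restrict Ω] h) : EqOn (bergmanRep u) h Ω :=
  Measure.eqOn_open_of_ae_eq ((coeFn_ae_eq_bergmanRep u).symm.trans hu) hΩ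
    (differentiableOn_bergmanRep u).continuousOn hh.continuousOn

theorem bergmanRep_add (hΩ : IsOpen Ω) (u v : bergmanSpace Ω) {z : Fin n → ℂ} (hz : z ∈ Ω) :
    bergmanRep (u + v) z = bergmanRep u z + bergmanRep v z :=
  bergmanRep_eqOn hΩ ((differentiableOn_bergmanRep u).add (differentiableOn_bergmanRep v))
    ((Lp.coeFn_add _ _).trans ((coeFn_ae_eq_bergmanRep u).add (coeFn_ae_eq_bergmanRep v))) hz

theorem bergmanRep_smul (hΩ : IsOpen Ω) (c : ℂ) (u : bergmanSpace Ω) {z : Fin n → ℂ} (hz : z ∈ Ω) :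
    bergmanRep (c • u) z = c * bergmanRep u z :=
  bergmanRep_eqOn hΩ ((differentiableOn_bergmanRep u).const_smul c)
    ((Lp.coeFn_smul _ _).trans ((coeFn_ae_eq_bergmanRep u).const_smul c)) hz

/-- The constant depends on the radius only, which is what makes evaluation bounds locally uniform
in the point. -/
theorem exists_norm_bergmanRep_le (r : ℝ) (hr : 0 < r) :
    ∃ C : ℝ, 0 ≤ C ∧ ∀ z, ball z r ⊆ Ω → ∀ u : bergmanSpace Ω, ‖bergmanRep u z‖ ≤ C * ‖u‖ :=
  ⟨_, by positivity, fun _ hz u => norm_le_of_ae_eq_of_ball_subset (half_pos hr) (half_lt_self hr)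
    hz (differentiableOn_bergmanRep u) (coeFn_ae_eq_bergmanRep u)⟩

theorem exists_ball_norm_bergmanRep_le (hΩ : IsOpen Ω) {z : Fin n → ℂ} (hz : z ∈ Ω) :
    ∃ r > 0, ∃ C : ℝ, 0 ≤ C ∧ ball z r ⊆ Ω ∧
      ∀ w ∈ ball z r, ∀ u : bergmanSpace Ω, ‖bergmanRep u w‖ ≤ C * ‖u‖ := by
  obtain ⟨R, hR, hball⟩ := Metric.isOpen_iff.1 hΩ z hz
  obtain ⟨C, hC0, hC⟩ := exists_norm_bergmanRep_le (Ω := Ω) (R / 2) (by positivity)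
  refine ⟨R / 2, by positivity, C, hC0, (ball_subset_ball (by linarith)).trans hball,
    fun w hw => hC w ?_⟩
  exact (ball_subset_ball' (by linarith [mem_ball.1 hw])).trans hball

/-- The Bergman space of an open set is closed in `L²`. -/
theorem isClosed_bergmanSpace (hΩ : IsOpen Ω) :
    IsClosed (bergmanSpace Ω : Set (Lp ℂ 2 ((volume : Measure (Fin n → ℂ)).restrict Ω))) := by
  refine isClosed_of_closure_subset fun u hu => ?_
  obtain ⟨v, hv, hlim⟩ := mem_closure_iff_seq_limit.1 hu
  set s : ℕ → bergmanSpace Ω := fun k => ⟨v k, hv k⟩ with hs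
  have hcs : CauchySeq s := by
    rw [cauchySeq_iff_le_tendsto_0]
    obtain ⟨b, hb⟩ := cauchySeq_iff_le_tendsto_0.1 hlim.cauchySeq
    exact ⟨b, hb⟩
  have hdist : ∀ {z}, z ∈ Ω → ∀ k l, bergmanRep (s k) z - bergmanRep (s l) z =
      bergmanRep (s k - s l) z := by
    intro z hz k l
    have h1 := bergmanRep_add hΩ (s k - s l) (s l) hz
    rw [sub_add_cancel] at h1
    rw [h1]; ring
  -- `L²` convergence forces locally uniform convergence of the representatives, so their limit is
  -- holomorphic.
  have hunif : ∀ z ∈ Ω, ∃ r > 0, ball z r ⊆ Ω ∧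
      UniformCauchySeqOn (fun k => bergmanRep (s k)) atTop (ball z r) := by
    intro z hz
    obtain ⟨r, hr, C, hC0, hsub, hC⟩ := exists_ball_norm_bergmanRep_le hΩ hz
    refine ⟨r, hr, hsub, ?_⟩
    rw [Metric.uniformCauchySeqOn_iff]
    intro ε hε
    obtain ⟨N, hN⟩ := Metric.cauchySeq_iff.1 hcs (ε / (C + 1)) (by positivity)
    refine ⟨N, fun m hm l hl x hx => ?_⟩
    rw [dist_eq_norm, hdist (hsub hx)]
    have h1 := hN m hm l hl
    rw [dist_eq_norm, lt_div_iff₀ (by positivity)] at h1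
    have h2 := hC x hx (s m - s l)
    nlinarith [norm_nonneg (s m - s l)]
  have hpt : ∀ z, ∃ c, z ∈ Ω → Tendsto (fun k => bergmanRep (s k) z) atTop (𝓝 c) := by
    intro z
    by_cases hz : z ∈ Ω
    · obtain ⟨r, hr, -, hc⟩ := hunif z hz
      obtain ⟨c, hc⟩ := cauchySeq_tendsto_of_complete (hc.cauchySeq (mem_ball_self hr))
      exact ⟨c, fun _ => hc⟩
    · exact ⟨0, fun h => absurd h hz⟩
  choose h hh using hpt
  refine ⟨h, fun z hz => ?_, ?_⟩
  · obtain ⟨r, hr, hsub, hc⟩ := hunif z hz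
    exact (differentiableAt_of_tendstoUniformlyOn_ball hr
      (fun k => (differentiableOn_bergmanRep (s k)).mono hsub)
      (hc.tendstoUniformlyOn_of_tendsto fun x hx => hh x (hsub hx))).differentiableWithinAt
  -- A subsequence converges almost everywhere to the `L²` limit, which identifies that limit with
  -- the pointwise one.
  · obtain ⟨ns, hns, hae⟩ := (tendstoInMeasure_of_tendsto_Lp hlim).exists_seq_tendsto_ae
    have hrep : ∀ᵐ x ∂(volume.restrict Ω), ∀ k, (v k) x = bergmanRep (s k) x :=
      ae_all_iff.2 fun k => coeFn_ae_eq_bergmanRep (s k)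
    filter_upwards [hae, hrep, ae_restrict_mem hΩ.measurableSet] with x hx1 hx2 hx3
    refine tendsto_nhds_unique hx1 ?_
    simp only [hx2]
    exact (hh x hx3).comp hns.tendsto_atTop

end BergmanSpace

/-! ### The Bergman map into `ℓ²` -/

section Evaluation

variable {n : ℕ} {Ω : Set (Fin n → ℂ)}

open Classical in
/-- Evaluation at `z ∈ Ω` as a continuous linear functional on `A²(Ω)`. -/
noncomputable def bergmanEval (hΩ : IsOpen Ω) (z : Fin n → ℂ) : StrongDual ℂ (bergmanSpace Ω) :=
  if hz : z ∈ Ω then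
    LinearMap.mkContinuousOfExistsBound
      { toFun := fun u => bergmanRep u z
        map_add' := fun u v => bergmanRep_add hΩ u v hz
        map_smul' := fun c u => bergmanRep_smul hΩ c u hz }
      (by
        obtain ⟨r, hr, C, -, -, hC⟩ := exists_ball_norm_bergmanRep_le hΩ hz
        exact ⟨C, hC z (mem_ball_self hr)⟩)
  else 0

theorem bergmanEval_apply (hΩ : IsOpen Ω) {z : Fin n → ℂ} (hz : z ∈ Ω) (u : bergmanSpace Ω) :
    bergmanEval hΩ z u = bergmanRep u z := by
  rw [bergmanEval, dif_pos hz]; rfl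

/-- Against each fixed `u` this is the holomorphic function `u` itself; the locally uniform
evaluation bound lifts this to the dual norm. -/
theorem differentiableOn_bergmanEval (hΩ : IsOpen Ω) :
    DifferentiableOn ℂ (bergmanEval hΩ) Ω := by
  intro z hz
  obtain ⟨r, hr, C, hC0, hsub, hC⟩ := exists_ball_norm_bergmanRep_le hΩ hz
  refine (differentiableAt_clm_of_apply hr (fun u => ?_) (C := C)
    fun w hw => ?_).differentiableWithinAt
  · exact ((differentiableOn_bergmanRep u).mono hsub).congr fun w hw =>
      bergmanEval_apply hΩ (hsub hw) u
  · refine ContinuousLinearMap.opNorm_le_bound _ hC0 fun u => ?_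
    rw [bergmanEval_apply hΩ (hsub hw)]
    exact hC w hw u

theorem completeSpace_bergmanSpace (hΩ : IsOpen Ω) : CompleteSpace (bergmanSpace Ω) :=
  (isClosed_bergmanSpace hΩ).completeSpace_coe

/-- `bergmanBasis Ω` as a Hilbert basis of `A²(Ω)`. -/
theorem exists_hilbertBasis_bergmanBasis (hΩ : IsOpen Ω) :
    ∃ b : HilbertBasis (bergmanBasis Ω) ℂ (bergmanSpace Ω), ∀ s, b s = s := by
  have := completeSpace_bergmanSpace hΩ
  obtain ⟨h1, h2⟩ : IsCompleteOrthonormalSystem (bergmanBasis Ω) :=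
    Classical.choose_spec (exists_isCompleteOrthonormalSystem Ω)
  have hsp : (Submodule.span ℂ (Set.range fun s : bergmanBasis Ω => (s : bergmanSpace Ω)))ᗮ = ⊥ := by
    rw [Submodule.eq_bot_iff]
    intro u hu
    refine h2 u fun s hs => ?_
    exact (Submodule.mem_orthogonal _ _).1 hu s (Submodule.subset_span ⟨⟨s, hs⟩, rfl⟩)
  exact ⟨HilbertBasis.mkOfOrthogonalEqBot h1 hsp, fun s => by simp⟩

/-- A bounded holomorphic function on a bounded domain belongs to the Bergman space. -/
theorem exists_bergmanRep_eqOn (hΩ : IsBoundedDomain Ω) {h : (Fin n → ℂ) → ℂ}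
    (hh : DifferentiableOn ℂ h Ω) {C : ℝ} (hC : ∀ z ∈ Ω, ‖h z‖ ≤ C) :
    ∃ u : bergmanSpace Ω, EqOn (bergmanRep u) h Ω := by
  have : IsFiniteMeasure ((volume : Measure (Fin n → ℂ)).restrict Ω) :=
    ⟨by rw [Measure.restrict_apply_univ]; exact hΩ.isBounded.measure_lt_top⟩
  have hm : MemLp h 2 ((volume : Measure (Fin n → ℂ)).restrict Ω) :=
    MemLp.of_bound (hh.continuousOn.aestronglyMeasurable hΩ.isOpen.measurableSet) C
      ((ae_restrict_mem hΩ.isOpen.measurableSet).mono hC)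
  exact ⟨⟨hm.toLp h, h, hh, hm.coeFn_toLp⟩, bergmanRep_eqOn hΩ.isOpen hh hm.coeFn_toLp⟩

/-- The dual of a Hilbert space is isometric to the space `ℓ²` over the index set of a Hilbert
basis. -/
theorem HilbertBasis.exists_strongDual_equiv {ι A : Type*} [NormedAddCommGroup A]
    [InnerProductSpace ℂ A] [CompleteSpace A] (b : HilbertBasis ι ℂ A) :
    ∃ T : StrongDual ℂ A ≃ₗᵢ[ℂ] lp (fun _ : ι => ℂ) 2,
      ∀ φ, inner ℂ (T φ) (T φ) = ∑' i, φ (b i) * conj (φ (b i)) := by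
  -- The Riesz identification is conjugate-linear; composing with coordinatewise conjugation on `ℓ²`
  -- restores linearity, needed for `Φ` to be holomorphic.
  refine ⟨((InnerProductSpace.toDual ℂ A).symm.trans b.repr).trans (starₗᵢ ℂ), fun φ => ?_⟩
  set T := ((InnerProductSpace.toDual ℂ A).symm.trans b.repr).trans
    (starₗᵢ ℂ : lp (fun _ : ι => ℂ) 2 ≃ₗᵢ⋆[ℂ] lp (fun _ : ι => ℂ) 2)
  set e := (InnerProductSpace.toDual ℂ A).symm φ with he
  have hes : ∀ s : A, inner ℂ e s = φ s := fun s => by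
    rw [he, InnerProductSpace.toDual_symm_apply]
  have h2 : inner ℂ (T φ) (T φ) = inner ℂ e e := by
    rw [inner_self_eq_norm_sq_to_K, inner_self_eq_norm_sq_to_K, T.norm_map, he,
      LinearIsometryEquiv.norm_map]
  rw [h2, ← b.tsum_inner_mul_inner e e]
  refine tsum_congr fun s => ?_
  rw [hes, ← inner_conj_symm, hes]

theorem exists_strongDual_bergmanSpace_equiv (hΩ : IsOpen Ω) :
    ∃ T : StrongDual ℂ (bergmanSpace Ω) ≃ₗᵢ[ℂ] lp (fun _ : bergmanBasis Ω => ℂ) 2,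
      ∀ φ, inner ℂ (T φ) (T φ) =
        ∑' s : bergmanBasis Ω, φ (s : bergmanSpace Ω) * conj (φ (s : bergmanSpace Ω)) := by
  have := completeSpace_bergmanSpace hΩ
  refine Exists.elim (exists_hilbertBasis_bergmanBasis hΩ) fun b hb => ?_
  simpa only [hb] using b.exists_strongDual_equiv

theorem DifferentiableOn.strongDual_equiv_comp {E A H : Type*} [NormedAddCommGroup E]
    [NormedSpace ℂ E] [NormedAddCommGroup A] [NormedSpace ℂ A] [NormedAddCommGroup H]
    [NormedSpace ℂ H] {F : E → StrongDual ℂ A} {s : Set E} (hF : DifferentiableOn ℂ F s)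
    (T : StrongDual ℂ A ≃ₗᵢ[ℂ] H) : DifferentiableOn ℂ (fun z => T (F z)) s :=
  T.differentiable.comp_differentiableOn hF

/-- `Φ z` is the evaluation functional at `z`, transported by `T`. Each `u` in the Bergman space
acts on it as a continuous functional with value `u(z)`; `ℓ` comes from `u = 1` and `π` from the
coordinate functions, square-integrable because `Ω` is bounded. -/
theorem exists_bergmanMap_of_equiv {H : Type*} [NormedAddCommGroup H] [InnerProductSpace ℂ H]
    (hΩ : IsBoundedDomain Ω) (T : StrongDual ℂ (bergmanSpace Ω) ≃ₗᵢ[ℂ] H)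
    (hT : ∀ φ, inner ℂ (T φ) (T φ) =
      ∑' s : bergmanBasis Ω, φ (s : bergmanSpace Ω) * conj (φ (s : bergmanSpace Ω))) :
    ∃ Φ : (Fin n → ℂ) → H, DifferentiableOn ℂ Φ Ω ∧
      (∀ z ∈ Ω, bergmanKernel Ω z z = inner ℂ (Φ z) (Φ z)) ∧
      (∃ ℓ : H →L[ℂ] ℂ, ∀ z ∈ Ω, ℓ (Φ z) = 1) ∧
      ∃ π : H →L[ℂ] (Fin n → ℂ), ∀ z ∈ Ω, π (Φ z) = z := by
  have hO := hΩ.isOpen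
  have hev : ∀ u : bergmanSpace Ω, ∃ ℓ : H →L[ℂ] ℂ,
      ∀ z ∈ Ω, ℓ (T (bergmanEval hO z)) = bergmanRep u z := fun u =>
    ⟨(ContinuousLinearMap.apply ℂ ℂ u).comp (T.symm.toContinuousLinearEquiv :
      H →L[ℂ] StrongDual ℂ (bergmanSpace Ω)), fun z hz => by
      change T.symm (T (bergmanEval hO z)) u = _
      rw [T.symm_apply_apply, bergmanEval_apply hO hz]⟩
  choose ℓ hℓ using hev
  obtain ⟨R, hR⟩ := hΩ.isBounded.exists_norm_le
  obtain ⟨u₀, hu₀⟩ := exists_bergmanRep_eqOn hΩ (h := fun _ => 1) (differentiableOn_const 1) (C := 1)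
    (by simp)
  have hcoord : ∀ i : Fin n, ∃ u : bergmanSpace Ω, EqOn (bergmanRep u) (fun z => z i) Ω := fun i =>
    exists_bergmanRep_eqOn hΩ (differentiable_apply i).differentiableOn (C := R)
      fun z hz => (norm_le_pi_norm z i).trans (hR z hz)
  choose u hu using hcoord
  refine ⟨fun z => T (bergmanEval hO z), ?_, fun z hz => ?_,
    ⟨ℓ u₀, fun z hz => (hℓ u₀ z hz).trans (hu₀ hz)⟩,
    ⟨ContinuousLinearMap.pi fun i => ℓ (u i), fun z hz => ?_⟩⟩
  · exact (differentiableOn_bergmanEval hO).strongDual_equiv_comp T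
  · rw [hT, bergmanKernel]
    refine tsum_congr fun s => ?_
    rw [bergmanEval_apply hO hz]
  · ext i
    exact (hℓ (u i) z hz).trans (hu i hz)

/-- The Bergman map of a bounded domain into a Hilbert space: a holomorphic map `Φ` with
`K(z, z) = ‖Φ z‖²`, which in suitable affine coordinates has the identity as a component. -/
theorem exists_bergmanMap (hΩ : IsBoundedDomain Ω) :
    ∃ Φ : (Fin n → ℂ) → lp (fun _ : bergmanBasis Ω => ℂ) 2, DifferentiableOn ℂ Φ Ω ∧
      (∀ z ∈ Ω, bergmanKernel Ω z z = inner ℂ (Φ z) (Φ z)) ∧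
      (∃ ℓ : lp (fun _ : bergmanBasis Ω => ℂ) 2 →L[ℂ] ℂ, ∀ z ∈ Ω, ℓ (Φ z) = 1) ∧
      ∃ π : lp (fun _ : bergmanBasis Ω => ℂ) 2 →L[ℂ] (Fin n → ℂ), ∀ z ∈ Ω, π (Φ z) = z :=
  Exists.elim (exists_strongDual_bergmanSpace_equiv hΩ.isOpen) fun T hT =>
    exists_bergmanMap_of_equiv hΩ T hT

end Evaluation

/-! ### The Bergman metric as a pullback of the Fubini-Study form -/

section Metric

variable {n : ℕ} {H : Type*} [NormedAddCommGroup H] [InnerProductSpace ℂ H]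

/-- The pullback of the Fubini-Study form: the polarization of `∂∂̄ log ‖p‖²`. -/
noncomputable def fubiniStudy (p a b : H) : ℂ :=
  (inner ℂ p p * inner ℂ b a - inner ℂ p a * inner ℂ b p) / inner ℂ p p ^ 2

theorem fubiniStudy_sum_sum {ι : Type*} (s : Finset ι) (p : H) (v : ι → H) (X Y : ι → ℂ) :
    fubiniStudy p (∑ i ∈ s, X i • v i) (∑ j ∈ s, Y j • v j) =
      ∑ i ∈ s, ∑ j ∈ s, fubiniStudy p (v i) (v j) * X i * conj (Y j) := by
  simp only [fubiniStudy, inner_sum, sum_inner, inner_smul_left, inner_smul_right,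
    Finset.mul_sum, Finset.sum_mul, sub_div, Finset.sum_div, Finset.sum_sub_distrib, sub_mul]
  congr 1
  · exact Finset.sum_congr rfl fun i _ => Finset.sum_congr rfl fun j _ => by ring
  · rw [Finset.sum_comm]
    exact Finset.sum_congr rfl fun i _ => Finset.sum_congr rfl fun j _ => by ring

/-- The pairing is only real-differentiable. Of the two terms of `L v`, the first is complex-linear
and the second antilinear in `v`, so each Wirtinger operator will pick out one of them. -/
theorem hasFDerivAt_inner_of_differentiableAt {E : Type*} [NormedAddCommGroup E] [NormedSpace ℂ E]
    {A B : E → H} {z : E} (hA : DifferentiableAt ℂ A z) (hB : DifferentiableAt ℂ B z) :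
    ∃ L : E →L[ℝ] ℂ, HasFDerivAt (fun w => inner ℂ (A w) (B w)) L z ∧
      ∀ v, L v = inner ℂ (A z) (fderiv ℂ B z v) + inner ℂ (fderiv ℂ A z v) (B z) :=
  letI := NormedSpace.complexToReal (E := E)
  ⟨_, (hA.hasFDerivAt.restrictScalars ℝ).inner ℂ (hB.hasFDerivAt.restrictScalars ℝ), fun v => by
    simp⟩

theorem single_I_eq_smul (α : Fin n) :
    (Pi.single α Complex.I : Fin n → ℂ) = Complex.I • Pi.single α 1 := by
  rw [← Pi.single_smul, smul_eq_mul, mul_one]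

/-- The Wirtinger derivative `∂∕∂z̄_β` of `log ⟪Φ, Φ⟫` for holomorphic `Φ`. -/
theorem wirtingerDzbar_log_inner_self {Φ : (Fin n → ℂ) → H} {z : Fin n → ℂ}
    (hΦ : DifferentiableAt ℂ Φ z) (h0 : Φ z ≠ 0) (β : Fin n) :
    wirtingerDzbar β (fun w => ((Real.log (inner ℂ (Φ w) (Φ w)).re : ℝ) : ℂ)) z =
      inner ℂ (fderiv ℂ Φ z (Pi.single β 1)) (Φ z) / inner ℂ (Φ z) (Φ z) := by
  obtain ⟨L, hL, hLv⟩ := hasFDerivAt_inner_of_differentiableAt hΦ hΦ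
  have hq : inner ℂ (Φ z) (Φ z) = (((inner ℂ (Φ z) (Φ z)).re : ℝ) : ℂ) :=
    (inner_self_ofReal_re (𝕜 := ℂ) (Φ z)).symm
  have hq0 : (inner ℂ (Φ z) (Φ z)).re ≠ 0 := fun h => h0 (by
    rw [h, Complex.ofReal_zero] at hq
    exact inner_self_eq_zero.1 hq)
  have h1 := (Complex.ofRealCLM.hasFDerivAt).comp z
    (((Complex.reCLM.hasFDerivAt).comp z hL).log hq0)
  have h2 : ∀ v, fderiv ℝ (fun w => ((Real.log (inner ℂ (Φ w) (Φ w)).re : ℝ) : ℂ)) z v =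
      L v / inner ℂ (Φ z) (Φ z) := by
    intro v
    -- The two terms of `L v` are conjugate to each other, so passing to the real part under the
    -- logarithm loses nothing.
    have h3 : (((L v).re : ℝ) : ℂ) = L v := by
      rw [Complex.re_eq_add_conj, hLv, map_add, inner_conj_symm, inner_conj_symm]
      ring
    have h4 := congrArg (fun T : (Fin n → ℂ) →L[ℝ] ℂ => T v) h1.fderiv
    refine h4.trans ?_
    rw [hq]
    simp only [ContinuousLinearMap.comp_apply, _root_.smul_apply,
      Complex.ofRealCLM_apply, Complex.reCLM_apply, smul_eq_mul, Complex.ofReal_mul,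
      Complex.ofReal_inv, h3]
    rw [div_eq_inv_mul]
    rfl
  rw [wirtingerDzbar, h2, h2, hLv, hLv, single_I_eq_smul, map_smul, inner_smul_left,
    inner_smul_right, Complex.conj_I]
  have hI := Complex.I_mul_I
  have hne : (inner ℂ (Φ z) (Φ z) : ℂ) ≠ 0 := inner_self_ne_zero.2 h0
  field_simp
  linear_combination (inner ℂ (Φ z) (fderiv ℂ Φ z (Pi.single β 1)) -
    inner ℂ (fderiv ℂ Φ z (Pi.single β 1)) (Φ z)) * hI

/-- The operator `∂/∂z_α` does not see the conjugate-linear slots, so only `B` and `D` are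
differentiated. It is applied to `⟪∂_β Φ, Φ⟫ / ⟪Φ, Φ⟫`. -/
theorem wirtingerDz_inner_div_inner {A B C D : (Fin n → ℂ) → H} {z : Fin n → ℂ}
    (hA : DifferentiableAt ℂ A z) (hB : DifferentiableAt ℂ B z) (hC : DifferentiableAt ℂ C z)
    (hD : DifferentiableAt ℂ D z) (h0 : inner ℂ (C z) (D z) ≠ 0) (α : Fin n) :
    wirtingerDz α (fun w => inner ℂ (A w) (B w) / inner ℂ (C w) (D w)) z =
      (inner ℂ (C z) (D z) * inner ℂ (A z) (fderiv ℂ B z (Pi.single α 1)) -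
        inner ℂ (C z) (fderiv ℂ D z (Pi.single α 1)) * inner ℂ (A z) (B z)) /
        inner ℂ (C z) (D z) ^ 2 := by
  obtain ⟨L, hL, hLv⟩ := hasFDerivAt_inner_of_differentiableAt hA hB
  obtain ⟨M, hM, hMv⟩ := hasFDerivAt_inner_of_differentiableAt hC hD
  have h2 : ∀ v, fderiv ℝ (fun w => inner ℂ (A w) (B w) / inner ℂ (C w) (D w)) z v =
      (inner ℂ (C z) (D z) * L v - inner ℂ (A z) (B z) * M v) / inner ℂ (C z) (D z) ^ 2 := by
    intro v
    have h4 := (hL.mul ((hasDerivAt_inv h0).comp_hasFDerivAt z hM)).fderiv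
    simp only [div_eq_mul_inv]
    refine (congrArg (fun T : (Fin n → ℂ) →L[ℝ] ℂ => T v) h4).trans ?_
    simp
    field_simp
    ring
  rw [wirtingerDz, h2, h2, hLv, hLv, hMv, hMv, single_I_eq_smul, map_smul, map_smul, map_smul,
    map_smul]
  simp only [inner_smul_left, inner_smul_right, Complex.conj_I]
  have hI := Complex.I_mul_I
  field_simp
  ring_nf
  simp only [Complex.I_sq]
  ring

/-- The Bergman metric in terms of the Bergman map. -/
theorem bergmanMetric_eq_fubiniStudy [CompleteSpace H] {Ω : Set (Fin n → ℂ)} (hΩ : IsOpen Ω)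
    {Φ : (Fin n → ℂ) → H} (hΦ : DifferentiableOn ℂ Φ Ω) (h0 : ∀ z ∈ Ω, Φ z ≠ 0)
    (hK : ∀ z ∈ Ω, bergmanKernel Ω z z = inner ℂ (Φ z) (Φ z)) {z : Fin n → ℂ} (hz : z ∈ Ω)
    (X Y : Fin n → ℂ) :
    bergmanMetric Ω z X Y = fubiniStudy (Φ z) (fderiv ℂ Φ z X) (fderiv ℂ Φ z Y) := by
  have hd : ∀ w ∈ Ω, DifferentiableAt ℂ Φ w := fun w hw => hΦ.differentiableAt (hΩ.mem_nhds hw)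
  have hfd : ∀ w ∈ Ω, fderiv ℝ (fun w => ((Real.log (bergmanKernel Ω w w).re : ℝ) : ℂ)) w =
      fderiv ℝ (fun w => ((Real.log (inner ℂ (Φ w) (Φ w)).re : ℝ) : ℂ)) w := fun w hw =>
    Filter.EventuallyEq.fderiv_eq (by
      filter_upwards [hΩ.mem_nhds hw] with x hx
      rw [hK x hx])
  have hcoef : ∀ α β, bergmanMetricCoeff Ω z α β = fubiniStudy (Φ z)
      (fderiv ℂ Φ z (Pi.single α 1)) (fderiv ℂ Φ z (Pi.single β 1)) := by
    intro α β
    have hbar : (wirtingerDzbar β fun w => ((Real.log (bergmanKernel Ω w w).re : ℝ) : ℂ)) =ᶠ[𝓝 z]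
        fun w => inner ℂ (fderiv ℂ Φ w (Pi.single β 1)) (Φ w) / inner ℂ (Φ w) (Φ w) := by
      filter_upwards [hΩ.mem_nhds hz] with w hw
      rw [← wirtingerDzbar_log_inner_self (hd w hw) (h0 w hw), wirtingerDzbar, hfd w hw]
      rfl
    rw [bergmanMetricCoeff, wirtingerDz, hbar.fderiv_eq]
    exact wirtingerDz_inner_div_inner
      ((differentiableOn_fderiv_apply hΩ hΦ _).differentiableAt (hΩ.mem_nhds hz)) (hd z hz)
      (hd z hz) (hd z hz) (inner_self_ne_zero.2 (h0 z hz)) α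
  have hsum : ∀ X : Fin n → ℂ, fderiv ℂ Φ z X = ∑ i, X i • fderiv ℂ Φ z (Pi.single i 1) := by
    intro X
    conv_lhs => rw [pi_eq_sum_univ' X]
    simp only [map_sum, map_smul]
  rw [hsum X, hsum Y, fubiniStudy_sum_sum, bergmanMetric]
  simp only [hcoef]

end Metric

/-! ### Polarization and the local rigidity of the diastasis -/

section Polarization

/-- A holomorphic function on a disc that vanishes on the real diameter is zero. -/
theorem eqOn_zero_ball_of_real {g : ℂ → ℂ} {ε : ℝ} (hε : 0 < ε)
    (hg : DifferentiableOn ℂ g (ball 0 ε)) (h0 : ∀ x : ℝ, |x| < ε → g x = 0) :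
    EqOn g 0 (ball 0 ε) := by
  refine (hg.analyticOnNhd isOpen_ball).eqOn_zero_of_preconnected_of_frequently_eq_zero
    (convex_ball 0 ε).isPreconnected (mem_ball_self hε) ?_
  have hlim : Tendsto (fun x : ℝ => (x : ℂ)) (𝓝[≠] 0) (𝓝[≠] 0) := by
    refine tendsto_nhdsWithin_iff.2 ⟨?_, ?_⟩
    · exact (Complex.continuous_ofReal.tendsto' 0 0 Complex.ofReal_zero).mono_left
        nhdsWithin_le_nhds
    · filter_upwards [self_mem_nhdsWithin] with x hx
      simpa using hx
  have hev : ∀ᶠ x : ℝ in 𝓝[≠] 0, g x = 0 := by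
    filter_upwards [nhdsWithin_le_nhds (ball_mem_nhds (0 : ℝ) hε)] with x hx
    exact h0 x (by simpa using hx)
  exact hlim.frequently hev.frequently

/-- The polarization principle: a holomorphic function of two variables vanishing on
`{(t, t̄)}` is zero. -/
theorem eq_zero_of_forall_conj_eq_zero {M : ℂ × ℂ → ℂ} {δ : ℝ} (hδ : 0 < δ)
    (hM : DifferentiableOn ℂ M (ball 0 δ ×ˢ ball 0 δ))
    (h0 : ∀ t ∈ ball (0 : ℂ) δ, M (t, conj t) = 0) {t s : ℂ} (ht : t ∈ ball (0 : ℂ) (δ / 2))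
    (hs : s ∈ ball (0 : ℂ) (δ / 2)) : M (t, s) = 0 := by
  have hopen : IsOpen (ball (0 : ℂ) δ ×ˢ ball (0 : ℂ) δ) := isOpen_ball.prod isOpen_ball
  -- In the coordinates `(x + iy, x - iy)` the set `{(t, t̄)}` is the locus of real `x` and `y`.
  -- Vanishing there extends to complex `x`, then to complex `y`. Radius `δ / 2` keeps `|x| + |y| <
  -- δ`.
  have hmem : ∀ x ∈ ball (0 : ℂ) (δ / 2), ∀ y ∈ ball (0 : ℂ) (δ / 2),
      (x + Complex.I * y, x - Complex.I * y) ∈ ball (0 : ℂ) δ ×ˢ ball (0 : ℂ) δ := by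
    intro x hx y hy
    rw [mem_ball_zero_iff] at hx hy
    refine ⟨mem_ball_zero_iff.2 ?_, mem_ball_zero_iff.2 ?_⟩
    · calc _ ≤ ‖x‖ + ‖Complex.I * y‖ := norm_add_le _ _
        _ < δ := by rw [norm_mul, Complex.norm_I]; linarith
    · calc _ ≤ ‖x‖ + ‖Complex.I * y‖ := norm_sub_le _ _
        _ < δ := by rw [norm_mul, Complex.norm_I]; linarith
  have hd : ∀ x ∈ ball (0 : ℂ) (δ / 2), ∀ y ∈ ball (0 : ℂ) (δ / 2),
      DifferentiableAt ℂ M (x + Complex.I * y, x - Complex.I * y) := fun x hx y hy =>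
    hM.differentiableAt (hopen.mem_nhds (hmem x hx y hy))
  have hreal : ∀ y : ℝ, |y| < δ / 2 → ∀ x ∈ ball (0 : ℂ) (δ / 2),
      M (x + Complex.I * y, x - Complex.I * y) = 0 := by
    intro y hy
    have hy' : (y : ℂ) ∈ ball (0 : ℂ) (δ / 2) := by simpa using hy
    refine eqOn_zero_ball_of_real (g := fun x => M (x + Complex.I * y, x - Complex.I * y))
      (by positivity) (fun x hx => ?_) fun x hx => ?_
    · exact ((hd x hx y hy').comp (f := fun x : ℂ => (x + Complex.I * y, x - Complex.I * y)) x
        (by fun_prop)).differentiableWithinAt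
    · have hx' : (x : ℂ) ∈ ball (0 : ℂ) (δ / 2) := by simpa using hx
      have := h0 _ (hmem x hx' y hy').1
      simpa [sub_eq_add_neg] using this
  have hall : ∀ x ∈ ball (0 : ℂ) (δ / 2), ∀ y ∈ ball (0 : ℂ) (δ / 2),
      M (x + Complex.I * y, x - Complex.I * y) = 0 := by
    intro x hx
    refine eqOn_zero_ball_of_real (g := fun y => M (x + Complex.I * y, x - Complex.I * y))
      (by positivity) (fun y hy => ?_) fun y hy => hreal y hy x hx
    exact ((hd x hx y hy).comp (f := fun y : ℂ => (x + Complex.I * y, x - Complex.I * y)) y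
      (by fun_prop)).differentiableWithinAt
  rw [mem_ball_zero_iff] at ht hs
  have h := hall ((t + s) / 2) ?_ ((t - s) / (2 * Complex.I)) ?_
  · have hI := Complex.I_ne_zero
    convert h using 3 <;> field_simp <;> ring
  · rw [mem_ball_zero_iff, norm_div, Complex.norm_ofNat]
    linarith [norm_add_le t s]
  · rw [mem_ball_zero_iff, norm_div, norm_mul, Complex.norm_ofNat, Complex.norm_I]
    linarith [norm_sub_le t s]

variable {H : Type*} [NormedAddCommGroup H] [InnerProductSpace ℂ H]

/-- Two conjugations cancel, that of the argument and that of the antilinear slot, so the result is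
holomorphic in `s`. -/
theorem hasDerivAt_innerSL_conj {A : ℂ → H} {A' : H} {s : ℂ} (hA : HasDerivAt A A' (conj s)) :
    HasDerivAt (fun s => innerSL ℂ (A (conj s))) (innerSL ℂ A') s := by
  rw [hasDerivAt_iff_tendsto_slope] at hA ⊢
  have hconj : Tendsto (conj : ℂ → ℂ) (𝓝[≠] s) (𝓝[≠] (conj s)) := by
    refine tendsto_nhdsWithin_iff.2 ⟨Complex.continuous_conj.continuousAt.mono_left
      nhdsWithin_le_nhds, ?_⟩
    filter_upwards [self_mem_nhdsWithin] with x hx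
    simpa [(starRingEnd ℂ).injective.eq_iff] using hx
  refine (((innerSL ℂ).continuous.tendsto A').comp (hA.comp hconj)).congr fun x => ?_
  simp only [Function.comp_apply, slope_def_module, map_smulₛₗ, map_sub, map_inv₀,
    Complex.conj_conj]

theorem differentiableOn_inner_conj {A B : ℂ → H} {R : ℝ} (hA : DifferentiableOn ℂ A (ball 0 R))
    (hB : DifferentiableOn ℂ B (ball 0 R)) :
    DifferentiableOn ℂ (fun p : ℂ × ℂ => inner ℂ (A (conj p.2)) (B p.1))
      (ball 0 R ×ˢ ball 0 R) := by
  rintro ⟨t, s⟩ ⟨ht, hs⟩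
  have hs' : conj s ∈ ball (0 : ℂ) R := by simpa using hs
  have h1 : DifferentiableAt ℂ (fun s => innerSL ℂ (A (conj s))) s :=
    (hasDerivAt_innerSL_conj
      (hA.differentiableAt (isOpen_ball.mem_nhds hs')).hasDerivAt).differentiableAt
  have h2 : DifferentiableAt ℂ B t := hB.differentiableAt (isOpen_ball.mem_nhds ht)
  have h3 : DifferentiableAt ℂ (fun p : ℂ × ℂ => innerSL ℂ (A (conj p.2))) (t, s) :=
    DifferentiableAt.comp (t, s) (f := Prod.snd) h1 differentiableAt_snd
  have h4 : DifferentiableAt ℂ (fun p : ℂ × ℂ => B p.1) (t, s) :=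
    DifferentiableAt.comp (t, s) (f := Prod.fst) h2 differentiableAt_fst
  exact (h3.clm_apply h4).differentiableWithinAt

theorem hasDerivAt_inner_conj_left {A : ℂ → H} {A' : H} {s : ℂ} (hA : HasDerivAt A A' (conj s))
    (v : H) : HasDerivAt (fun s => inner ℂ (A (conj s)) v) (inner ℂ A' v) s := by
  simpa using (hasDerivAt_innerSL_conj hA).clm_apply (hasDerivAt_const s v)

theorem hasDerivAt_inner_const_left {B : ℂ → H} {B' : H} {t : ℂ} (hB : HasDerivAt B B' t)
    (v : H) : HasDerivAt (fun t => inner ℂ v (B t)) (inner ℂ v B') t := by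
  exact (innerSL ℂ v).hasFDerivAt.comp_hasDerivAt t hB

/-- At the origin the pairing is `‖ψ 0‖² > 0`, so by continuity it stays where the principal
logarithm is holomorphic. -/
theorem exists_ball_inner_conj_mem_slitPlane {ψ : ℂ → H} {R : ℝ} (hR : 0 < R)
    (hψ : DifferentiableOn ℂ ψ (ball 0 R)) (h0 : ψ 0 ≠ 0) :
    ∃ δ > 0, ∀ t ∈ ball (0 : ℂ) δ, ∀ s ∈ ball (0 : ℂ) δ,
      inner ℂ (ψ (conj s)) (ψ t) ∈ Complex.slitPlane := by
  have hcont : ContinuousAt (fun p : ℂ × ℂ => inner ℂ (ψ (conj p.2)) (ψ p.1)) (0, 0) :=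
    (differentiableOn_inner_conj hψ hψ).continuousOn.continuousAt
      ((isOpen_ball.prod isOpen_ball).mem_nhds ⟨mem_ball_self hR, mem_ball_self hR⟩)
  have hmem : inner ℂ (ψ (conj (0 : ℂ))) (ψ 0) ∈ Complex.slitPlane := by
    rw [map_zero, inner_self_eq_norm_sq_to_K]
    have : (0 : ℝ) < ‖ψ 0‖ ^ 2 := by positivity
    exact_mod_cast Complex.ofReal_mem_slitPlane.2 this
  obtain ⟨δ, hδ, h⟩ := Metric.mem_nhds_iff.1
    (hcont.preimage_mem_nhds (Complex.isOpen_slitPlane.mem_nhds hmem))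
  refine ⟨δ, hδ, fun t ht s hs => ?_⟩
  have hts : (t, s) ∈ ball ((0 : ℂ), (0 : ℂ)) δ := by
    rw [mem_ball, Prod.dist_eq]
    exact max_lt ht hs
  exact h hts

/-- The polarized Fubini-Study form of a holomorphic curve. -/
noncomputable def polarizedFubiniStudy (ψ : ℂ → H) (p : ℂ × ℂ) : ℂ :=
  (inner ℂ (ψ (conj p.2)) (ψ p.1) * inner ℂ (deriv ψ (conj p.2)) (deriv ψ p.1) -
    inner ℂ (ψ (conj p.2)) (deriv ψ p.1) * inner ℂ (deriv ψ (conj p.2)) (ψ p.1)) /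
    inner ℂ (ψ (conj p.2)) (ψ p.1) ^ 2

theorem differentiableOn_polarizedFubiniStudy [CompleteSpace H] {ψ : ℂ → H} {δ : ℝ}
    (hψ : DifferentiableOn ℂ ψ (ball 0 δ))
    (h0 : ∀ t ∈ ball (0 : ℂ) δ, ∀ s ∈ ball (0 : ℂ) δ, inner ℂ (ψ (conj s)) (ψ t) ≠ 0) :
    DifferentiableOn ℂ (polarizedFubiniStudy ψ) (ball 0 δ ×ˢ ball 0 δ) := by
  have hd := hψ.deriv isOpen_ball
  have heq : polarizedFubiniStudy ψ = fun p => _ * _ := funext fun p => div_eq_mul_inv _ _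
  rw [heq]
  exact (((differentiableOn_inner_conj hψ hψ).mul (differentiableOn_inner_conj hd hd)).sub
    ((differentiableOn_inner_conj hψ hd).mul (differentiableOn_inner_conj hd hψ))).mul
    (((differentiableOn_inner_conj hψ hψ).fun_pow 2).fun_inv
    fun p (hp : p ∈ ball (0 : ℂ) δ ×ˢ ball (0 : ℂ) δ) => pow_ne_zero 2 (h0 _ hp.1 _ hp.2))

theorem polarizedFubiniStudy_conj (ψ : ℂ → H) (t : ℂ) :
    polarizedFubiniStudy ψ (t, conj t) = fubiniStudy (ψ t) (deriv ψ t) (deriv ψ t) := by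
  simp [polarizedFubiniStudy, fubiniStudy]

/-- The quotient is `∂_t log ⟪ψ(s̄), ψ(t)⟫`, so the polarized form is the mixed derivative `∂_s ∂_t`
of this logarithm. -/
theorem hasDerivAt_inner_conj_div {ψ : ℂ → H} {δ : ℝ} (hψ : DifferentiableOn ℂ ψ (ball 0 δ))
    {t s : ℂ} (hs : s ∈ ball (0 : ℂ) δ)
    (h0 : inner ℂ (ψ (conj s)) (ψ t) ≠ 0) :
    HasDerivAt (fun s => inner ℂ (ψ (conj s)) (deriv ψ t) / inner ℂ (ψ (conj s)) (ψ t))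
      (polarizedFubiniStudy ψ (t, s)) s := by
  have hs' : conj s ∈ ball (0 : ℂ) δ := by simpa using hs
  have h1 := (hψ.differentiableAt (isOpen_ball.mem_nhds hs')).hasDerivAt
  refine ((hasDerivAt_inner_conj_left h1 (deriv ψ t)).div
    (hasDerivAt_inner_conj_left h1 (ψ t)) h0).congr_deriv ?_
  simp only [polarizedFubiniStudy]
  ring

theorem hasDerivAt_log_inner {ψ : ℂ → H} {t : ℂ} (hψ : DifferentiableAt ℂ ψ t) {v : H}
    (h0 : inner ℂ v (ψ t) ∈ Complex.slitPlane) :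
    HasDerivAt (fun t => Complex.log (inner ℂ v (ψ t)))
      (inner ℂ v (deriv ψ t) / inner ℂ v (ψ t)) t :=
  (hasDerivAt_inner_const_left hψ.hasDerivAt v).clog h0

/-- The logarithm of the Calabi ratio of a pair of vectors. -/
noncomputable def logRatio (p q : H) : ℝ :=
  Real.log (‖q‖ ^ 2) + Real.log (‖p‖ ^ 2) - 2 * Real.log ‖inner ℂ p q‖

/-- Calabi's rigidity of the diastasis, along a holomorphic curve near its initial point. -/
theorem exists_ball_logRatio_eq {H' : Type*} [NormedAddCommGroup H'] [InnerProductSpace ℂ H']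
    [CompleteSpace H] [CompleteSpace H'] {ψ : ℂ → H} {φ : ℂ → H'} {R c : ℝ} (hR : 0 < R)
    (hψ : DifferentiableOn ℂ ψ (ball 0 R)) (hφ : DifferentiableOn ℂ φ (ball 0 R))
    (hψ0 : ψ 0 ≠ 0) (hφ0 : φ 0 ≠ 0)
    (h : ∀ t ∈ ball (0 : ℂ) R, fubiniStudy (ψ t) (deriv ψ t) (deriv ψ t) =
      c * fubiniStudy (φ t) (deriv φ t) (deriv φ t)) :
    ∃ δ > 0, ∀ t ∈ ball (0 : ℂ) δ, inner ℂ (ψ 0) (ψ t) ≠ 0 ∧ inner ℂ (φ 0) (φ t) ≠ 0 ∧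
      logRatio (ψ 0) (ψ t) = c * logRatio (φ 0) (φ t) := by
  obtain ⟨δ₁, hδ₁, hs₁⟩ := exists_ball_inner_conj_mem_slitPlane hR hψ hψ0
  obtain ⟨δ₂, hδ₂, hs₂⟩ := exists_ball_inner_conj_mem_slitPlane hR hφ hφ0
  set δ := min R (min δ₁ δ₂) with hδdef
  have hδ : 0 < δ := lt_min hR (lt_min hδ₁ hδ₂)
  have hbR : ball (0 : ℂ) δ ⊆ ball 0 R := ball_subset_ball (min_le_left _ _)
  have hb1 : ball (0 : ℂ) δ ⊆ ball 0 δ₁ :=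
    ball_subset_ball ((min_le_right _ _).trans (min_le_left _ _))
  have hb2 : ball (0 : ℂ) δ ⊆ ball 0 δ₂ :=
    ball_subset_ball ((min_le_right _ _).trans (min_le_right _ _))
  replace hs₁ : ∀ t ∈ ball (0 : ℂ) δ, ∀ s ∈ ball (0 : ℂ) δ,
    inner ℂ (ψ (conj s)) (ψ t) ∈ Complex.slitPlane := fun t ht s hs => hs₁ t (hb1 ht) s (hb1 hs)
  replace hs₂ : ∀ t ∈ ball (0 : ℂ) δ, ∀ s ∈ ball (0 : ℂ) δ,
    inner ℂ (φ (conj s)) (φ t) ∈ Complex.slitPlane := fun t ht s hs => hs₂ t (hb2 ht) s (hb2 hs)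
  have hn₁ := fun t ht s hs => Complex.slitPlane_ne_zero (hs₁ t ht s hs)
  have hn₂ := fun t ht s hs => Complex.slitPlane_ne_zero (hs₂ t ht s hs)
  replace hψ := hψ.mono hbR
  replace hφ := hφ.mono hbR
  set ρ := δ / 2 with hρ
  have hρ0 : 0 < ρ := by positivity
  have hsub : ball (0 : ℂ) ρ ⊆ ball 0 δ := ball_subset_ball (by linarith)
  have hconn : IsPreconnected (ball (0 : ℂ) ρ) := (convex_ball 0 ρ).isPreconnected
  have hz : (0 : ℂ) ∈ ball (0 : ℂ) ρ := mem_ball_self hρ0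
  have hpol : ∀ t ∈ ball (0 : ℂ) ρ, ∀ s ∈ ball (0 : ℂ) ρ,
      polarizedFubiniStudy ψ (t, s) - c * polarizedFubiniStudy φ (t, s) = 0 := fun t ht s hs =>
    eq_zero_of_forall_conj_eq_zero (M := fun p => polarizedFubiniStudy ψ p -
      c * polarizedFubiniStudy φ p) hδ ((differentiableOn_polarizedFubiniStudy hψ hn₁).sub
        ((differentiableOn_polarizedFubiniStudy hφ hn₂).const_mul _))
      (fun t ht => by
        rw [polarizedFubiniStudy_conj, polarizedFubiniStudy_conj, h t (hbR ht), sub_self]) ht hs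
  -- First integration, in `s` from `0`; `hlog` then integrates in `t` from `0`.
  have hstep : ∀ t ∈ ball (0 : ℂ) ρ, ∀ s ∈ ball (0 : ℂ) ρ,
      inner ℂ (ψ (conj s)) (deriv ψ t) / inner ℂ (ψ (conj s)) (ψ t) -
        c * (inner ℂ (φ (conj s)) (deriv φ t) / inner ℂ (φ (conj s)) (φ t)) =
      inner ℂ (ψ 0) (deriv ψ t) / inner ℂ (ψ 0) (ψ t) -
        c * (inner ℂ (φ 0) (deriv φ t) / inner ℂ (φ 0) (φ t)) := by
    intro t ht s hs
    have hder : ∀ s ∈ ball (0 : ℂ) ρ, HasDerivAt (fun s =>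
        inner ℂ (ψ (conj s)) (deriv ψ t) / inner ℂ (ψ (conj s)) (ψ t) -
        c * (inner ℂ (φ (conj s)) (deriv φ t) / inner ℂ (φ (conj s)) (φ t))) 0 s := by
      intro s hs
      rw [← hpol t ht s hs]
      exact (hasDerivAt_inner_conj_div hψ (hsub hs) (hn₁ t (hsub ht) s (hsub hs))).sub
        ((hasDerivAt_inner_conj_div hφ (hsub hs) (hn₂ t (hsub ht) s (hsub hs))).const_mul _)
    have := isOpen_ball.is_const_of_deriv_eq_zero hconn
      (fun s hs => (hder s hs).differentiableAt.differentiableWithinAt)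
      (fun s hs => (hder s hs).deriv) hs hz
    simpa using this
  have hlog : ∀ t ∈ ball (0 : ℂ) ρ, ∀ s ∈ ball (0 : ℂ) ρ,
      (Complex.log (inner ℂ (ψ (conj s)) (ψ t)) - Complex.log (inner ℂ (ψ 0) (ψ t))) -
        c * (Complex.log (inner ℂ (φ (conj s)) (φ t)) - Complex.log (inner ℂ (φ 0) (φ t))) =
      (Complex.log (inner ℂ (ψ (conj s)) (ψ 0)) - Complex.log (inner ℂ (ψ 0) (ψ 0))) -
        c * (Complex.log (inner ℂ (φ (conj s)) (φ 0)) - Complex.log (inner ℂ (φ 0) (φ 0))) := by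
    intro t ht s hs
    have hder : ∀ t ∈ ball (0 : ℂ) ρ, HasDerivAt (fun t =>
        (Complex.log (inner ℂ (ψ (conj s)) (ψ t)) - Complex.log (inner ℂ (ψ 0) (ψ t))) -
        c * (Complex.log (inner ℂ (φ (conj s)) (φ t)) - Complex.log (inner ℂ (φ 0) (φ t)))) 0 t := by
      intro t ht
      have h1 := hψ.differentiableAt (isOpen_ball.mem_nhds (hsub ht))
      have h2 := hφ.differentiableAt (isOpen_ball.mem_nhds (hsub ht))
      have e1 := hs₁ t (hsub ht) 0 (hsub hz)
      have e2 := hs₂ t (hsub ht) 0 (hsub hz)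
      rw [map_zero] at e1 e2
      refine (((hasDerivAt_log_inner h1 (hs₁ t (hsub ht) s (hsub hs))).sub
        (hasDerivAt_log_inner h1 e1)).sub
        (((hasDerivAt_log_inner h2 (hs₂ t (hsub ht) s (hsub hs))).sub
        (hasDerivAt_log_inner h2 e2)).const_mul (c : ℂ))).congr_deriv ?_
      linear_combination hstep t ht s hs
    exact isOpen_ball.is_const_of_deriv_eq_zero hconn
      (fun t ht => (hder t ht).differentiableAt.differentiableWithinAt)
      (fun t ht => (hder t ht).deriv) ht hz
  refine ⟨ρ, hρ0, fun t ht => ?_⟩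
  have ht' : conj t ∈ ball (0 : ℂ) ρ := by simpa using ht
  have e1 := hn₁ t (hsub ht) 0 (hsub hz)
  have e2 := hn₂ t (hsub ht) 0 (hsub hz)
  rw [map_zero] at e1 e2
  refine ⟨e1, e2, ?_⟩
  -- Setting `s = t̄` and taking real parts turns the logarithms into `log` of norms, which is the
  -- diastasis identity.
  have key := congrArg Complex.re (hlog t ht (conj t) ht')
  simp only [Complex.conj_conj, Complex.sub_re, Complex.re_ofReal_mul, Complex.log_re,
    norm_inner_symm (ψ t) (ψ 0), norm_inner_symm (φ t) (φ 0)] at key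
  simp only [inner_self_eq_norm_sq_to_K, norm_pow, RCLike.norm_ofReal, abs_norm] at key
  simp only [logRatio]
  linear_combination key

end Polarization

/-! ### Analytic continuation to the whole domain -/

section Continuation

open scoped ContDiff

/-- A disc minus a countable set is connected. -/
theorem isPreconnected_ball_diff_of_countable {r : ℝ} (hr : 0 < r) {Z : Set ℂ} (hZ : Z.Countable) :
    IsPreconnected (ball (0 : ℂ) r \ Z) := by
  -- The disc is homeomorphic to the plane, where the complement of a countable set is connected.
  set e := OpenPartialHomeomorph.univBall (0 : ℂ) r with he
  have hsrc : e.source = univ := OpenPartialHomeomorph.univBall_source 0 r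
  have htgt : e.target = ball 0 r := OpenPartialHomeomorph.univBall_target 0 hr
  have hinj : InjOn e (e ⁻¹' Z) := e.injOn.mono (by rw [hsrc]; exact subset_univ _)
  have hconn : IsPreconnected (e ⁻¹' Z)ᶜ :=
    ((hZ.preimage_of_injOn hinj).isConnected_compl_of_one_lt_rank
      (by rw [Complex.rank_real_complex]; exact Cardinal.one_lt_two)).isPreconnected
  have himg : e '' (e ⁻¹' Z)ᶜ = ball (0 : ℂ) r \ Z := by
    ext z
    constructor
    · rintro ⟨w, hw, rfl⟩
      exact ⟨htgt ▸ e.map_source (by rw [hsrc]; trivial), hw⟩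
    · rintro ⟨hz, hzZ⟩
      have h1 : e (e.symm z) = z := e.right_inv (htgt.symm ▸ hz)
      exact ⟨e.symm z, by rw [mem_compl_iff, mem_preimage, h1]; exact hzZ, h1⟩
  rw [← himg]
  exact hconn.image _ (OpenPartialHomeomorph.continuous_univBall 0 r).continuousOn

/-- Isolated zeros form a discrete subspace, and a discrete Lindelöf space is countable. -/
theorem countable_zeros_of_eventually_ne {g : ℂ → ℂ} {D : Set ℂ}
    (h : ∀ t ∈ D, ∀ᶠ w in 𝓝[≠] t, g w ≠ 0) : {t ∈ D | g t = 0}.Countable := by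
  refine (HereditarilyLindelofSpace.isLindelof _).countable ?_
  rw [discreteTopology_subtype_iff]
  rintro t ⟨ht, -⟩
  rw [inf_principal_eq_bot]
  filter_upwards [h t ht] with w hw hmem
  exact hw hmem.2

variable {H H' : Type*} [NormedAddCommGroup H] [InnerProductSpace ℂ H]
  [NormedAddCommGroup H'] [InnerProductSpace ℂ H']

/-- The relation `Q(p, x) = Q(q, y) ^ c` between the normalized squares
`Q(p, x) = |⟪p, x⟫|² / (‖p‖² ‖x‖²)`, with the denominators cleared. -/
def CalabiRelation (c : ℝ) (p x : H) (q y : H') : Prop :=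
  ‖inner ℂ p x‖ ^ 2 * (‖q‖ ^ 2 * ‖y‖ ^ 2) ^ c =
    (‖inner ℂ q y‖ ^ 2) ^ c * (‖p‖ ^ 2 * ‖x‖ ^ 2)

theorem calabiRelation_of_logRatio_eq {c : ℝ} {p x : H} {q y : H'} (hpx : inner ℂ p x ≠ 0)
    (hqy : inner ℂ q y ≠ 0) (h : logRatio p x = c * logRatio q y) : CalabiRelation c p x q y := by
  have hp : p ≠ 0 := fun h => hpx (by simp [h])
  have hx : x ≠ 0 := fun h => hpx (by simp [h])
  have hq : q ≠ 0 := fun h => hqy (by simp [h])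
  have hy : y ≠ 0 := fun h => hqy (by simp [h])
  refine Real.log_injOn_pos (mem_Ioi.2 (by positivity)) (mem_Ioi.2 (by positivity)) ?_
  rw [Real.log_mul (by positivity) (by positivity), Real.log_mul (by positivity) (by positivity),
    Real.log_rpow (by positivity), Real.log_rpow (by positivity),
    Real.log_mul (by positivity) (by positivity), Real.log_mul (by positivity) (by positivity),
    Real.log_pow ‖inner ℂ p x‖, Real.log_pow ‖inner ℂ q y‖]
  simp only [logRatio] at h
  push_cast
  linear_combination -h

variable {E : Type*} [NormedAddCommGroup E] [NormedSpace ℂ E] {Ω : Set E}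

/-- Continuation of a property along complex discs in a connected open set. -/
theorem forall_mem_of_continuation (hΩ : IsOpen Ω) (hconn : IsPreconnected Ω) {P : E → Prop} {a : E}
    (ha : a ∈ Ω) (h0 : ∀ᶠ w in 𝓝 a, P w)
    (hstep : ∀ q z, (∀ t ∈ ball (0 : ℂ) 2, q + t • (z - q) ∈ Ω) → (∀ᶠ w in 𝓝 q, P w) → P z) :
    ∀ z ∈ Ω, P z := by
  have hopen : IsOpen {z | ∀ᶠ w in 𝓝 z, P w} := isOpen_setOfPred_eventually_nhds
  have hsub : Ω ⊆ {z | ∀ᶠ w in 𝓝 z, P w} := by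
    refine hconn.subset_of_closure_inter_subset hopen ⟨a, ha, h0⟩ ?_
    rintro z ⟨hzcl, hz⟩
    obtain ⟨R, hR, hball⟩ := Metric.isOpen_iff.1 hΩ z hz
    -- With `‖q - z‖ < R/5` and `‖w - q‖ < 2R/5`, the disc of parameter radius `2` through `q` and
    -- `w` stays in `ball z R`. Radius `2` puts `w`, at `t = 1`, in its interior.
    obtain ⟨q, hq, hqz⟩ := Metric.mem_closure_iff.1 hzcl (R / 5) (by positivity)
    filter_upwards [ball_mem_nhds z (by positivity : 0 < R / 5)] with w hw
    refine hstep q w (fun t ht => hball ?_) hq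
    rw [mem_ball_zero_iff] at ht
    rw [mem_ball, dist_eq_norm] at hw
    rw [dist_comm, dist_eq_norm] at hqz
    have hwq : ‖w - q‖ < 2 * (R / 5) := by
      have := norm_sub_le (w - z) (q - z)
      rw [sub_sub_sub_cancel_right] at this
      linarith
    rw [mem_ball, dist_eq_norm]
    calc ‖q + t • (w - q) - z‖ = ‖(q - z) + t • (w - q)‖ := by congr 1; abel
      _ ≤ ‖q - z‖ + ‖t‖ * ‖w - q‖ := (norm_add_le _ _).trans (by rw [norm_smul])
      _ ≤ ‖q - z‖ + 2 * ‖w - q‖ := by gcongr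
      _ < R := by linarith
  exact fun z hz => (hsub hz).self_of_nhds

theorem differentiableOn_comp_line {F : E → H} (hF : DifferentiableOn ℂ F Ω) {q v : E} {D : Set ℂ}
    (hD : ∀ t ∈ D, q + t • v ∈ Ω) : DifferentiableOn ℂ (fun t : ℂ => F (q + t • v)) D :=
  hF.comp (f := fun t : ℂ => q + t • v) (by fun_prop) hD

theorem deriv_comp_line {F : E → H} {q v : E} {t : ℂ} (hF : DifferentiableAt ℂ F (q + t • v)) :
    deriv (fun t : ℂ => F (q + t • v)) t = fderiv ℂ F (q + t • v) v := by
  have h1 : HasDerivAt (fun t : ℂ => q + t • v) v t := by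
    simpa using ((hasDerivAt_id t).smul_const v).const_add q
  exact (hF.hasFDerivAt.comp_hasDerivAt t h1).deriv

theorem eventually_comp_line {P : E → Prop} {q v : E} (h : ∀ᶠ w in 𝓝 q, P w) :
    ∀ᶠ t in 𝓝 (0 : ℂ), P (q + t • v) := by
  have : Tendsto (fun t : ℂ => q + t • v) (𝓝 0) (𝓝 q) :=
    Continuous.tendsto' (by fun_prop) _ _ (by simp)
  exact this.eventually h

variable [CompleteSpace H] [CompleteSpace H']

theorem contDiffAt_omega_of_differentiableOn {A : ℂ → H} {D : Set ℂ} (hD : IsOpen D)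
    (hA : DifferentiableOn ℂ A D) {t : ℂ} (ht : t ∈ D) : ContDiffAt ℝ ω A t :=
  (hA.analyticAt (hD.mem_nhds ht)).contDiffAt.restrict_scalars ℝ

theorem analyticAt_fubiniStudy {p a : ℂ → H} {D : Set ℂ} (hD : IsOpen D)
    (hp : DifferentiableOn ℂ p D) (ha : DifferentiableOn ℂ a D) {t : ℂ} (ht : t ∈ D)
    (h0 : p t ≠ 0) : AnalyticAt ℝ (fun t => fubiniStudy (p t) (a t) (a t)) t := by
  have hp' := contDiffAt_omega_of_differentiableOn hD hp ht
  have ha' := contDiffAt_omega_of_differentiableOn hD ha ht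
  exact ((((hp'.inner ℂ hp').mul (ha'.inner ℂ ha')).sub
    ((hp'.inner ℂ ha').mul (ha'.inner ℂ hp'))).mul
    (((hp'.inner ℂ hp').pow 2).inv (pow_ne_zero 2 (inner_self_ne_zero.2 h0)))).analyticAt

/-- For non-integral `c` the power of `|⟪q, φ⟫|²` need not be analytic at its zeros. The identity
theorem is therefore applied off the zeros of `⟪q, φ⟫`, a countable set whose removal keeps the disc
connected, and continuity fills them in. -/
theorem calabiRelation_ball_of_eventually {c r : ℝ} (hc : 0 < c) (hr : 0 < r) {ψ : ℂ → H}
    {φ : ℂ → H'} (hψ : DifferentiableOn ℂ ψ (ball 0 r)) (hφ : DifferentiableOn ℂ φ (ball 0 r))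
    (hφ0 : ∀ t ∈ ball (0 : ℂ) r, φ t ≠ 0)
    {p : H} {q : H'} (hq : q ≠ 0) (h : ∀ᶠ t in 𝓝 (0 : ℂ), CalabiRelation c p (ψ t) q (φ t)) :
    ∀ t ∈ ball (0 : ℂ) r, CalabiRelation c p (ψ t) q (φ t) := by
  have hzero := mem_ball_self (x := (0 : ℂ)) hr
  have hconn : IsPreconnected (ball (0 : ℂ) r) := (convex_ball 0 r).isPreconnected
  have hu : AnalyticOnNhd ℂ (fun t => inner ℂ p (ψ t)) (ball 0 r) :=
    ((innerSL ℂ p).differentiable.comp_differentiableOn hψ).analyticOnNhd isOpen_ball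
  have hg : AnalyticOnNhd ℂ (fun t => inner ℂ q (φ t)) (ball 0 r) :=
    ((innerSL ℂ q).differentiable.comp_differentiableOn hφ).analyticOnNhd isOpen_ball
  have hpos : ∀ t ∈ ball (0 : ℂ) r, 0 < ‖q‖ ^ 2 * ‖φ t‖ ^ 2 := fun t ht => by
    have := norm_pos_iff.2 (hφ0 t ht)
    have := norm_pos_iff.2 hq
    positivity
  -- If `⟪q, φ⟫` vanishes near the centre, the relation there forces `⟪p, ψ⟫ = 0`, and both
  -- functions vanish on the disc.
  rcases (hg 0 hzero).eventually_eq_zero_or_eventually_ne_zero with hz | hnz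
  · have hg0 := hg.eqOn_zero_of_preconnected_of_eventuallyEq_zero hconn hzero hz
    have hu0 := hu.eqOn_zero_of_preconnected_of_eventuallyEq_zero hconn hzero (by
      filter_upwards [hz, h, isOpen_ball.mem_nhds hzero] with t ht hrel htb
      rw [CalabiRelation, ht, norm_zero, zero_pow two_ne_zero, Real.zero_rpow hc.ne',
        zero_mul] at hrel
      have := (mul_eq_zero.1 hrel).resolve_right (Real.rpow_pos_of_pos (hpos t htb) c).ne'
      simpa using this)
    intro t ht
    have h1 : inner ℂ q (φ t) = 0 := hg0 ht
    have h2 : inner ℂ p (ψ t) = 0 := hu0 ht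
    rw [CalabiRelation, h1, h2]
    simp [Real.zero_rpow hc.ne']
  · have hne : ∀ t ∈ ball (0 : ℂ) r, ∀ᶠ w in 𝓝[≠] t, inner ℂ q (φ w) ≠ 0 := by
      intro t ht
      rcases (hg t ht).eventually_eq_zero_or_eventually_ne_zero with h1 | h1
      · have h2 := hg.eqOn_zero_of_preconnected_of_eventuallyEq_zero hconn ht h1
        obtain ⟨w, hw1, hw2⟩ :=
          (hnz.and (nhdsWithin_le_nhds (isOpen_ball.mem_nhds hzero))).exists
        exact absurd (h2 hw2) hw1
      · exact h1
    set Z := {t ∈ ball (0 : ℂ) r | inner ℂ q (φ t) = 0} with hZ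
    have hD : IsPreconnected (ball (0 : ℂ) r \ Z) :=
      isPreconnected_ball_diff_of_countable hr (countable_zeros_of_eventually_ne hne)
    set F : ℂ → ℝ := fun t => ‖inner ℂ p (ψ t)‖ ^ 2 * (‖q‖ ^ 2 * ‖φ t‖ ^ 2) ^ c -
      (‖inner ℂ q (φ t)‖ ^ 2) ^ c * (‖p‖ ^ 2 * ‖ψ t‖ ^ 2) with hF
    have hFiff : ∀ t, CalabiRelation c p (ψ t) q (φ t) ↔ F t = 0 := fun t => by
      rw [CalabiRelation, hF, sub_eq_zero]
    have hFan : AnalyticOnNhd ℝ F (ball (0 : ℂ) r \ Z) := by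
      rintro t ⟨ht, htZ⟩
      have hgt : inner ℂ q (φ t) ≠ 0 := fun h => htZ ⟨ht, h⟩
      have h1 := contDiffAt_omega_of_differentiableOn isOpen_ball hψ ht
      have h2 := contDiffAt_omega_of_differentiableOn isOpen_ball hφ ht
      have h3 : ContDiffAt ℝ ω (fun t => inner ℂ p (ψ t)) t := contDiffAt_const.inner ℂ h1
      have h4 : ContDiffAt ℝ ω (fun t => inner ℂ q (φ t)) t := contDiffAt_const.inner ℂ h2
      exact (((h3.norm_sq ℝ).mul ((contDiffAt_const.mul (h2.norm_sq ℂ)).rpow_const_of_ne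
        (hpos t ht).ne')).sub (((h4.norm_sq ℝ).rpow_const_of_ne (by positivity)).mul
        (contDiffAt_const.mul (h1.norm_sq ℂ)))).analyticAt
    -- The centre may itself be a zero, so the identity theorem starts from a nearby point off `Z`.
    obtain ⟨t₀, ht₀, hgt₀, ht₀b⟩ := ((eventually_eventually_nhds.2 h).filter_mono
      nhdsWithin_le_nhds |>.and (hnz.and (nhdsWithin_le_nhds (isOpen_ball.mem_nhds hzero)))).exists
    have hF0 := hFan.eqOn_zero_of_preconnected_of_eventuallyEq_zero hD
      (⟨ht₀b, fun h => hgt₀ h.2⟩ : t₀ ∈ ball (0 : ℂ) r \ Z)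
      (ht₀.mono fun t ht => (hFiff t).1 ht)
    intro t ht
    rw [hFiff]
    have hFc : ContinuousAt F t := by
      have h1 := (hψ.differentiableAt (isOpen_ball.mem_nhds ht)).continuousAt
      have h2 := (hφ.differentiableAt (isOpen_ball.mem_nhds ht)).continuousAt
      have h3 : ContinuousAt (fun t => inner ℂ p (ψ t)) t := (hu t ht).continuousAt
      have h4 : ContinuousAt (fun t => inner ℂ q (φ t)) t := (hg t ht).continuousAt
      exact ((h3.norm.pow 2).mul ((continuousAt_const.mul (h2.norm.pow 2)).rpow_const
        (Or.inr hc.le))).sub (((h4.norm.pow 2).rpow_const (Or.inr hc.le)).mul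
        (continuousAt_const.mul (h1.norm.pow 2)))
    refine tendsto_nhds_unique (hFc.tendsto.mono_left nhdsWithin_le_nhds : Tendsto F (𝓝[≠] t) _)
      (tendsto_const_nhds.congr' ?_)
    filter_upwards [hne t ht, nhdsWithin_le_nhds (isOpen_ball.mem_nhds ht)] with w hw hwb
    exact (hF0 ⟨hwb, fun h => hw h.2⟩).symm

/-- A homothety of Fubini-Study pullbacks on an open subset is a homothety everywhere. -/
theorem fubiniStudy_eq_of_eventually (hΩ : IsOpen Ω) (hconn : IsPreconnected Ω) {Ψ : E → H}
    {Φ : E → H'} (hΨ : DifferentiableOn ℂ Ψ Ω) (hΦ : DifferentiableOn ℂ Φ Ω)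
    (hΨ0 : ∀ z ∈ Ω, Ψ z ≠ 0) (hΦ0 : ∀ z ∈ Ω, Φ z ≠ 0) {c : ℂ} {a : E} (ha : a ∈ Ω) (X : E)
    (h : ∀ᶠ z in 𝓝 a, fubiniStudy (Ψ z) (fderiv ℂ Ψ z X) (fderiv ℂ Ψ z X) =
      c * fubiniStudy (Φ z) (fderiv ℂ Φ z X) (fderiv ℂ Φ z X)) :
    ∀ z ∈ Ω, fubiniStudy (Ψ z) (fderiv ℂ Ψ z X) (fderiv ℂ Ψ z X) =
      c * fubiniStudy (Φ z) (fderiv ℂ Φ z X) (fderiv ℂ Φ z X) := by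
  refine forall_mem_of_continuation hΩ hconn ha h fun q z hline hq => ?_
  have h1 : AnalyticOnNhd ℝ (fun t : ℂ => fubiniStudy (Ψ (q + t • (z - q)))
      (fderiv ℂ Ψ (q + t • (z - q)) X) (fderiv ℂ Ψ (q + t • (z - q)) X)) (ball 0 2) :=
    fun t ht => analyticAt_fubiniStudy isOpen_ball (differentiableOn_comp_line hΨ hline)
      (differentiableOn_comp_line (differentiableOn_fderiv_apply hΩ hΨ X) hline) ht
      (hΨ0 _ (hline t ht))
  have h2 : AnalyticOnNhd ℝ (fun t : ℂ => c * fubiniStudy (Φ (q + t • (z - q)))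
      (fderiv ℂ Φ (q + t • (z - q)) X) (fderiv ℂ Φ (q + t • (z - q)) X)) (ball 0 2) :=
    fun t ht => analyticAt_const.mul <| analyticAt_fubiniStudy isOpen_ball
      (differentiableOn_comp_line hΦ hline)
      (differentiableOn_comp_line (differentiableOn_fderiv_apply hΩ hΦ X) hline) ht
      (hΦ0 _ (hline t ht))
  have h3 := h1.eqOn_of_preconnected_of_eventuallyEq h2 (convex_ball (0 : ℂ) 2).isPreconnected
    (mem_ball_self two_pos) (eventually_comp_line hq)
  have h4 := h3 (show (1 : ℂ) ∈ ball (0 : ℂ) 2 by simp)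
  simpa using h4

/-- Calabi's global rigidity of the diastasis. -/
theorem calabiRelation_of_fubiniStudy_eq (hΩ : IsOpen Ω) (hconn : IsPreconnected Ω) {Ψ : E → H}
    {Φ : E → H'} (hΨ : DifferentiableOn ℂ Ψ Ω) (hΦ : DifferentiableOn ℂ Φ Ω)
    (hΨ0 : ∀ z ∈ Ω, Ψ z ≠ 0) (hΦ0 : ∀ z ∈ Ω, Φ z ≠ 0) {c : ℝ} (hc : 0 < c)
    (h : ∀ z ∈ Ω, ∀ X, fubiniStudy (Ψ z) (fderiv ℂ Ψ z X) (fderiv ℂ Ψ z X) =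
      c * fubiniStudy (Φ z) (fderiv ℂ Φ z X) (fderiv ℂ Φ z X)) {a z : E} (ha : a ∈ Ω)
    (hz : z ∈ Ω) : CalabiRelation c (Ψ a) (Ψ z) (Φ a) (Φ z) := by
  have hdisc : ∀ q z, (∀ t ∈ ball (0 : ℂ) 2, q + t • (z - q) ∈ Ω) →
      (∀ᶠ t in 𝓝 (0 : ℂ), CalabiRelation c (Ψ a) (Ψ (q + t • (z - q))) (Φ a)
        (Φ (q + t • (z - q)))) → CalabiRelation c (Ψ a) (Ψ z) (Φ a) (Φ z) := by
    intro q z hline hq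
    have h1 := calabiRelation_ball_of_eventually hc two_pos (differentiableOn_comp_line hΨ hline)
      (differentiableOn_comp_line hΦ hline) (fun t ht => hΦ0 _ (hline t ht)) (hΦ0 a ha) hq 1
      (by simp)
    simpa using h1
  refine forall_mem_of_continuation hΩ hconn (P := fun z => CalabiRelation c (Ψ a) (Ψ z) (Φ a)
    (Φ z)) ha ?_ (fun q z hline hq => hdisc q z hline (eventually_comp_line hq)) z hz
  obtain ⟨R, hR, hball⟩ := Metric.isOpen_iff.1 hΩ a ha
  filter_upwards [ball_mem_nhds a (by positivity : 0 < R / 2)] with w hw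
  have hline : ∀ t ∈ ball (0 : ℂ) 2, a + t • (w - a) ∈ Ω := by
    intro t ht
    refine hball ?_
    rw [mem_ball_zero_iff] at ht
    rw [mem_ball, dist_eq_norm] at hw
    rw [mem_ball, dist_eq_norm, add_sub_cancel_left, norm_smul]
    calc ‖t‖ * ‖w - a‖ ≤ 2 * ‖w - a‖ := by gcongr
      _ < R := by linarith
  have hdiffΨ : ∀ t ∈ ball (0 : ℂ) 2, DifferentiableAt ℂ Ψ (a + t • (w - a)) := fun t ht =>
    hΨ.differentiableAt (hΩ.mem_nhds (hline t ht))
  have hdiffΦ : ∀ t ∈ ball (0 : ℂ) 2, DifferentiableAt ℂ Φ (a + t • (w - a)) := fun t ht =>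
    hΦ.differentiableAt (hΩ.mem_nhds (hline t ht))
  obtain ⟨δ, hδ, hlog⟩ := exists_ball_logRatio_eq two_pos (differentiableOn_comp_line hΨ hline)
    (differentiableOn_comp_line hΦ hline) (c := c) (by simpa using hΨ0 a ha)
    (by simpa using hΦ0 a ha) (fun t ht => by
      rw [deriv_comp_line (hdiffΨ t ht), deriv_comp_line (hdiffΦ t ht)]
      exact h _ (hline t ht) _)
  -- The diastasis identity holds for `|t| < δ` only, with `δ` depending on the line. Continuation
  -- along the disc reaches `t = 1`, so the relation holds on a full neighbourhood of `a`.
  refine hdisc a w hline ?_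
  filter_upwards [ball_mem_nhds (0 : ℂ) hδ] with t ht
  obtain ⟨h1, h2, h3⟩ := hlog t ht
  simp only [zero_smul, add_zero] at h1 h2 h3
  exact calabiRelation_of_logRatio_eq h1 h2 h3

end Continuation

/-! ### Injectivity, immersion and the conclusion -/

section Biholomorphism

variable {n : ℕ}

/-- An injective proper holomorphic immersion of an open set into a domain of the same dimension
is a biholomorphism. -/
theorem isBiholomorphismOn_of_injOn {Ω₁ Ω₂ : Set (Fin n → ℂ)} (hΩ₁ : IsOpen Ω₁)
    (hne : Ω₁.Nonempty) (hΩ₂ : IsPreconnected Ω₂) {f : (Fin n → ℂ) → (Fin n → ℂ)}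
    (hmaps : MapsTo f Ω₁ Ω₂) (hholo : DifferentiableOn ℂ f Ω₁)
    (hproper : IsProperMap (MapsTo.restrict f Ω₁ Ω₂ hmaps)) (hinj : InjOn f Ω₁)
    (himm : ∀ z ∈ Ω₁, ∀ X, fderiv ℂ f z X = 0 → X = 0) : IsBiholomorphismOn f Ω₁ Ω₂ := by
  have hcont : ContinuousOn (fderiv ℂ f) Ω₁ :=
    continuousOn_clm_apply.2 fun X => (differentiableOn_fderiv_apply hΩ₁ hholo X).continuousOn
  have hstrict : ∀ z ∈ Ω₁, ∃ L : (Fin n → ℂ) ≃L[ℂ] (Fin n → ℂ),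
      HasStrictFDerivAt f (L : (Fin n → ℂ) →L[ℂ] (Fin n → ℂ)) z := by
    intro z hz
    -- In equal finite dimensions an injective derivative is invertible, and the inverse function
    -- theorem applies.
    have hinjL : Function.Injective (fderiv ℂ f z : (Fin n → ℂ) →ₗ[ℂ] (Fin n → ℂ)) :=
      (injective_iff_map_eq_zero _).2 fun X hX => himm z hz X hX
    refine ⟨(LinearEquiv.ofInjectiveEndo _ hinjL).toContinuousLinearEquiv, ?_⟩
    refine (hasStrictFDerivAt_of_hasFDerivAt_of_continuousAt (f' := fderiv ℂ f) ?_
      (hcont.continuousAt (hΩ₁.mem_nhds hz))).congr_fderiv (by ext; rfl)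
    filter_upwards [hΩ₁.mem_nhds hz] with w hw
    exact (hholo.differentiableAt (hΩ₁.mem_nhds hw)).hasFDerivAt
  have hmap : ∀ z ∈ Ω₁, map f (𝓝 z) = 𝓝 (f z) := fun z hz => by
    obtain ⟨L, hL⟩ := hstrict z hz
    exact hL.map_nhds_eq_of_equiv
  have himgopen : IsOpen (f '' Ω₁) := by
    rw [isOpen_iff_mem_nhds]
    rintro _ ⟨z, hz, rfl⟩
    rw [← hmap z hz]
    exact image_mem_map (hΩ₁.mem_nhds hz)
  have hrange : range (MapsTo.restrict f Ω₁ Ω₂ hmaps) = Subtype.val ⁻¹' (f '' Ω₁) := by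
    ext y
    constructor
    · rintro ⟨x, rfl⟩
      exact ⟨x, x.2, rfl⟩
    · rintro ⟨x, hx, hxy⟩
      exact ⟨⟨x, hx⟩, Subtype.ext hxy⟩
  have : PreconnectedSpace Ω₂ := Subtype.preconnectedSpace hΩ₂
  -- Closed by properness, open by the inverse function theorem.
  have hclopen : IsClopen (range (MapsTo.restrict f Ω₁ Ω₂ hmaps)) :=
    ⟨hproper.isClosedMap.isClosed_range, hrange ▸ himgopen.preimage continuous_subtype_val⟩
  have huniv : range (MapsTo.restrict f Ω₁ Ω₂ hmaps) = univ := by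
    obtain ⟨x, hx⟩ := hne
    exact hclopen.eq_univ ⟨_, ⟨⟨x, hx⟩, rfl⟩⟩
  have hsurj : SurjOn f Ω₁ Ω₂ := fun y hy => by
    have : (⟨y, hy⟩ : Ω₂) ∈ (Subtype.val ⁻¹' (f '' Ω₁) : Set Ω₂) := by
      rw [← hrange, huniv]; trivial
    exact this
  have hinv : InvOn (Function.invFunOn f Ω₁) f Ω₁ Ω₂ :=
    ⟨hinj.leftInvOn_invFunOn, hsurj.rightInvOn_invFunOn⟩
  refine ⟨hmaps, hholo, Function.invFunOn f Ω₁, hsurj.mapsTo_invFunOn, fun y hy => ?_, hinv⟩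
  obtain ⟨x, hx, rfl⟩ := hsurj hy
  obtain ⟨L, hL⟩ := hstrict x hx
  have hgx : Function.invFunOn f Ω₁ (f x) = x := hinv.1 hx
  refine (HasFDerivAt.of_local_left_inverse (f := f) (f' := L) ?_ (hgx.symm ▸ hL.hasFDerivAt)
    ?_).differentiableAt.differentiableWithinAt
  · rw [ContinuousAt, hgx, ← hmap x hx, tendsto_map'_iff]
    refine tendsto_id.congr' ?_
    filter_upwards [hΩ₁.mem_nhds hx] with w hw
    exact (hinv.1 hw).symm
  · rw [← hmap x hx, eventually_map]
    filter_upwards [hΩ₁.mem_nhds hx] with w hw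
    rw [hinv.1 hw]

variable {H₁ H₂ : Type*} [NormedAddCommGroup H₁] [InnerProductSpace ℂ H₁]
  [NormedAddCommGroup H₂] [InnerProductSpace ℂ H₂]

/-- The vanishing numerator is the equality case of Cauchy-Schwarz. -/
theorem eq_smul_of_fubiniStudy_self_eq_zero {p a : H₁} (hp : p ≠ 0)
    (h : fubiniStudy p a a = 0) : ∃ μ : ℂ, a = μ • p := by
  rcases eq_or_ne a 0 with rfl | ha
  · exact ⟨0, by simp⟩
  rw [fubiniStudy, div_eq_zero_iff, sub_eq_zero] at h
  replace h := h.resolve_right (pow_ne_zero 2 (inner_self_ne_zero.2 hp))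
  have h1 := congrArg norm h
  rw [norm_mul, norm_mul, norm_inner_symm a p, inner_self_eq_norm_sq_to_K,
    inner_self_eq_norm_sq_to_K, norm_pow, norm_pow, RCLike.norm_ofReal, RCLike.norm_ofReal,
    abs_norm, abs_norm, ← mul_pow, ← pow_two] at h1
  have h2 : ‖inner ℂ p a‖ = ‖p‖ * ‖a‖ :=
    ((sq_eq_sq₀ (by positivity) (by positivity)).1 h1).symm
  obtain ⟨r, -, hr⟩ := (norm_inner_eq_norm_iff hp ha).1 h2
  exact ⟨r, hr⟩

theorem ne_zero_of_clm_apply_eq_one {Ω : Set (Fin n → ℂ)} {Φ : (Fin n → ℂ) → H₁}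
    (h : ∃ ℓ : H₁ →L[ℂ] ℂ, ∀ z ∈ Ω, ℓ (Φ z) = 1) : ∀ z ∈ Ω, Φ z ≠ 0 := by
  obtain ⟨ℓ, hℓ⟩ := h
  intro z hz h0
  have := hℓ z hz
  rw [h0, map_zero] at this
  exact zero_ne_one this

/-- A local homothety between the pullbacks of the Fubini-Study forms under embeddings into
projective space is a biholomorphism if it is proper. -/
theorem isBiholomorphismOn_of_fubiniStudy [CompleteSpace H₁] [CompleteSpace H₂]
    {Ω₁ Ω₂ : Set (Fin n → ℂ)} (hΩ₁ : IsOpen Ω₁)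
    (hconn₁ : IsConnected Ω₁) (hΩ₂ : IsOpen Ω₂) (hconn₂ : IsPreconnected Ω₂)
    {f : (Fin n → ℂ) → (Fin n → ℂ)} (hmaps : MapsTo f Ω₁ Ω₂) (hholo : DifferentiableOn ℂ f Ω₁)
    (hproper : IsProperMap (MapsTo.restrict f Ω₁ Ω₂ hmaps)) {c : ℝ} (hc : 0 < c)
    {Φ₁ : (Fin n → ℂ) → H₁} {Φ₂ : (Fin n → ℂ) → H₂} (hΦ₁ : DifferentiableOn ℂ Φ₁ Ω₁)
    (hΦ₂ : DifferentiableOn ℂ Φ₂ Ω₂) (h0 : ∀ z ∈ Ω₂, Φ₂ z ≠ 0)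
    {ℓ : H₁ →L[ℂ] ℂ} (hℓ : ∀ z ∈ Ω₁, ℓ (Φ₁ z) = 1)
    {π : H₁ →L[ℂ] (Fin n → ℂ)} (hπ : ∀ z ∈ Ω₁, π (Φ₁ z) = z)
    {a : Fin n → ℂ} (ha : a ∈ Ω₁) (h : ∀ᶠ z in 𝓝 a, ∀ X,
      fubiniStudy (Φ₂ (f z)) (fderiv ℂ Φ₂ (f z) (fderiv ℂ f z X))
        (fderiv ℂ Φ₂ (f z) (fderiv ℂ f z X)) =
      c * fubiniStudy (Φ₁ z) (fderiv ℂ Φ₁ z X) (fderiv ℂ Φ₁ z X)) :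
    IsBiholomorphismOn f Ω₁ Ω₂ := by
  have h0₁ : ∀ z ∈ Ω₁, Φ₁ z ≠ 0 := ne_zero_of_clm_apply_eq_one ⟨ℓ, hℓ⟩
  have hdΦ₁ : ∀ z ∈ Ω₁, DifferentiableAt ℂ Φ₁ z := fun z hz =>
    hΦ₁.differentiableAt (hΩ₁.mem_nhds hz)
  have hdf : ∀ z ∈ Ω₁, DifferentiableAt ℂ f z := fun z hz =>
    hholo.differentiableAt (hΩ₁.mem_nhds hz)
  have hΨ : DifferentiableOn ℂ (fun z => Φ₂ (f z)) Ω₁ := hΦ₂.comp hholo hmaps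
  have hΨ0 : ∀ z ∈ Ω₁, Φ₂ (f z) ≠ 0 := fun z hz => h0 _ (hmaps hz)
  have hΨd : ∀ z ∈ Ω₁, ∀ X, fderiv ℂ (fun z => Φ₂ (f z)) z X =
      fderiv ℂ Φ₂ (f z) (fderiv ℂ f z X) := fun z hz X => by
    have := fderiv_comp z (hΦ₂.differentiableAt (hΩ₂.mem_nhds (hmaps hz))) (hdf z hz)
    exact congrArg (fun T : (Fin n → ℂ) →L[ℂ] H₂ => T X) this
  have hall : ∀ z ∈ Ω₁, ∀ X, fubiniStudy (Φ₂ (f z)) (fderiv ℂ (fun z => Φ₂ (f z)) z X)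
      (fderiv ℂ (fun z => Φ₂ (f z)) z X) =
      c * fubiniStudy (Φ₁ z) (fderiv ℂ Φ₁ z X) (fderiv ℂ Φ₁ z X) := fun z hz X =>
    fubiniStudy_eq_of_eventually hΩ₁ hconn₁.isPreconnected hΨ hΦ₁ hΨ0 h0₁ ha X
      (by
        filter_upwards [h, hΩ₁.mem_nhds ha] with w hw hwΩ
        rw [hΨd w hwΩ]
        exact hw X) z hz
  refine isBiholomorphismOn_of_injOn hΩ₁ hconn₁.nonempty hconn₂ hmaps hholo hproper
    (fun a ha z hz haz => ?_) fun z hz X hX => ?_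
  · have hrel := calabiRelation_of_fubiniStudy_eq hΩ₁ hconn₁.isPreconnected hΨ hΦ₁ hΨ0 h0₁ hc hall
      ha hz
    have hpos := norm_pos_iff.2 (hΨ0 z hz)
    rw [CalabiRelation, haz, inner_self_eq_norm_sq_to_K, norm_pow, RCLike.norm_ofReal, abs_norm,
      mul_comm] at hrel
    -- Since `f a = f z`, the factors from `Φ₂` cancel, leaving equality in Cauchy-Schwarz for `Φ₁
    -- a` and `Φ₁ z`.
    have h1 : (‖Φ₁ a‖ ^ 2 * ‖Φ₁ z‖ ^ 2) ^ c = (‖inner ℂ (Φ₁ a) (Φ₁ z)‖ ^ 2) ^ c :=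
      mul_right_cancel₀ (by positivity : ‖Φ₂ (f z)‖ ^ 2 * ‖Φ₂ (f z)‖ ^ 2 ≠ 0)
        (by linear_combination hrel)
    have h2 := (Real.rpow_left_inj (by positivity) (by positivity) hc.ne').1 h1
    rw [← mul_pow] at h2
    have h3 : ‖inner ℂ (Φ₁ a) (Φ₁ z)‖ = ‖Φ₁ a‖ * ‖Φ₁ z‖ :=
      ((sq_eq_sq₀ (by positivity) (by positivity)).1 h2).symm
    obtain ⟨r, -, hr⟩ := (norm_inner_eq_norm_iff (h0₁ a ha) (h0₁ z hz)).1 h3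
    -- The value `1` of `ℓ` on both vectors forces the proportionality factor to be `1`; then `π`
    -- recovers the points.
    have h4 := congrArg ℓ hr
    rw [map_smul, hℓ a ha, hℓ z hz, smul_eq_mul, mul_one] at h4
    rw [← hπ a ha, ← hπ z hz, hr, ← h4, one_smul]
  · have h1 := hall z hz X
    rw [hΨd z hz, hX, map_zero] at h1
    have h2 : fubiniStudy (Φ₁ z) (fderiv ℂ Φ₁ z X) (fderiv ℂ Φ₁ z X) = 0 := by
      have hc' : (c : ℂ) ≠ 0 := by exact_mod_cast hc.ne'
      refine (mul_eq_zero.1 (h1.symm.trans ?_)).resolve_left hc'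
      simp [fubiniStudy]
    obtain ⟨μ, hμ⟩ := eq_smul_of_fubiniStudy_self_eq_zero (h0₁ z hz) h2
    -- Differentiating the constant `ℓ ∘ Φ₁` along `X` gives `μ = 0`. Then `dΦ₁ X = 0`, and
    -- differentiating `π ∘ Φ₁ = id` gives `X = 0`.
    have hμ0 : μ = 0 := by
      have h3 : HasFDerivAt (fun z => ℓ (Φ₁ z)) (ℓ.comp (fderiv ℂ Φ₁ z)) z :=
        ℓ.hasFDerivAt.comp z (hdΦ₁ z hz).hasFDerivAt
      have h4 : HasFDerivAt (fun z => ℓ (Φ₁ z)) (0 : (Fin n → ℂ) →L[ℂ] ℂ) z :=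
        (hasFDerivAt_const (1 : ℂ) z).congr_of_eventuallyEq
          (by filter_upwards [hΩ₁.mem_nhds hz] with w hw using hℓ w hw)
      have h5 := congrArg (fun T : (Fin n → ℂ) →L[ℂ] ℂ => T X) (h3.unique h4)
      simp only [ContinuousLinearMap.comp_apply, hμ, map_smul, hℓ z hz] at h5
      simpa using h5
    have h3 : HasFDerivAt (fun z => π (Φ₁ z)) (π.comp (fderiv ℂ Φ₁ z)) z :=
      π.hasFDerivAt.comp z (hdΦ₁ z hz).hasFDerivAt
    have h4 : HasFDerivAt (fun z => π (Φ₁ z)) (ContinuousLinearMap.id ℂ (Fin n → ℂ)) z :=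
      (hasFDerivAt_id z).congr_of_eventuallyEq
        (by filter_upwards [hΩ₁.mem_nhds hz] with w hw using hπ w hw)
    have h5 := congrArg (fun T : (Fin n → ℂ) →L[ℂ] (Fin n → ℂ) => T X) (h3.unique h4)
    simpa [hμ, hμ0] using h5.symm

theorem isBiholomorphismOn_of_bergmanMaps [CompleteSpace H₁] [CompleteSpace H₂]
    {Ω₁ Ω₂ : Set (Fin n → ℂ)} (hΩ₁ : IsBoundedDomain Ω₁) (hΩ₂ : IsBoundedDomain Ω₂)
    {f : (Fin n → ℂ) → (Fin n → ℂ)} (hmaps : MapsTo f Ω₁ Ω₂) (hholo : DifferentiableOn ℂ f Ω₁)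
    (hproper : IsProperMap (MapsTo.restrict f Ω₁ Ω₂ hmaps)) {c : ℝ} (hc : 0 < c)
    {U : Set (Fin n → ℂ)} (hUopen : IsOpen U) (hUne : U.Nonempty) (hU : U ⊆ Ω₁)
    (hisom : ∀ z ∈ U, ∀ X Y : Fin n → ℂ,
      pullbackMetric f (bergmanMetric Ω₂) z X Y = (c : ℂ) * bergmanMetric Ω₁ z X Y)
    (h₁ : ∃ Φ : (Fin n → ℂ) → H₁, DifferentiableOn ℂ Φ Ω₁ ∧
      (∀ z ∈ Ω₁, bergmanKernel Ω₁ z z = inner ℂ (Φ z) (Φ z)) ∧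
      (∃ ℓ : H₁ →L[ℂ] ℂ, ∀ z ∈ Ω₁, ℓ (Φ z) = 1) ∧
      ∃ π : H₁ →L[ℂ] (Fin n → ℂ), ∀ z ∈ Ω₁, π (Φ z) = z)
    (h₂ : ∃ Φ : (Fin n → ℂ) → H₂, DifferentiableOn ℂ Φ Ω₂ ∧
      (∀ z ∈ Ω₂, bergmanKernel Ω₂ z z = inner ℂ (Φ z) (Φ z)) ∧
      (∃ ℓ : H₂ →L[ℂ] ℂ, ∀ z ∈ Ω₂, ℓ (Φ z) = 1) ∧
      ∃ π : H₂ →L[ℂ] (Fin n → ℂ), ∀ z ∈ Ω₂, π (Φ z) = z) :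
    IsBiholomorphismOn f Ω₁ Ω₂ := by
  obtain ⟨Φ₁, hΦ₁, hK₁, hone₁, π, hπ⟩ := h₁
  obtain ⟨Φ₂, hΦ₂, hK₂, hone₂, -⟩ := h₂
  have h0₁ := ne_zero_of_clm_apply_eq_one hone₁
  have h0₂ := ne_zero_of_clm_apply_eq_one hone₂
  obtain ⟨ℓ, hℓ⟩ := hone₁
  obtain ⟨a, ha⟩ := hUne
  refine isBiholomorphismOn_of_fubiniStudy hΩ₁.isOpen hΩ₁.isConnected hΩ₂.isOpen
    hΩ₂.isConnected.isPreconnected hmaps hholo hproper hc hΦ₁ hΦ₂ h0₂ hℓ hπ (hU ha) ?_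
  filter_upwards [hUopen.mem_nhds ha] with z hz X
  -- The diagonal values suffice, since the later polarization happens along complex lines.
  have hX := hisom z hz X X
  rwa [pullbackMetric, bergmanMetric_eq_fubiniStudy hΩ₂.isOpen hΦ₂ h0₂ hK₂ (hmaps (hU hz)),
    bergmanMetric_eq_fubiniStudy hΩ₁.isOpen hΦ₁ h0₁ hK₁ (hU hz)] at hX

end Biholomorphism

theorem theoremA (n : ℕ) (Ω₁ Ω₂ : Set (Fin n → ℂ))
    (hΩ₁ : IsBoundedDomain Ω₁) (hΩ₂ : IsBoundedDomain Ω₂)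
    (f : (Fin n → ℂ) → (Fin n → ℂ)) (hmaps : MapsTo f Ω₁ Ω₂)
    (hholo : DifferentiableOn ℂ f Ω₁)
    (hproper : IsProperMap (MapsTo.restrict f Ω₁ Ω₂ hmaps))
    (c : ℝ) (hc : 0 < c)
    (U : Set (Fin n → ℂ)) (hUopen : IsOpen U) (hUne : U.Nonempty) (hU : U ⊆ Ω₁)
    (hisom : ∀ z ∈ U, ∀ X Y : Fin n → ℂ,
      pullbackMetric f (bergmanMetric Ω₂) z X Y = (c : ℂ) * bergmanMetric Ω₁ z X Y) :
    IsBiholomorphismOn f Ω₁ Ω₂ :=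
  isBiholomorphismOn_of_bergmanMaps hΩ₁ hΩ₂ hmaps hholo hproper hc hUopen hUne hU hisom
    (exists_bergmanMap hΩ₁) (exists_bergmanMap hΩ₂)
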